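/- Let $v=e^{2\pi i/3}$ and let $\Delta\subset\mathbb C$ be the (solid) equilateral triangle with unit side length and corners $w_0=0$, $w_1=-v$, $w_2=1$ (anticlockwise order, indices modulo $3$). Let $X=\mathbb C\setminus\Delta$. The singular set $\mathcal S$ is the intersection of $X$ with the three half-lines that start at $w_{i+1}$ and pass through $w_i$, $i=0,1,2$. The set $X\setminus\mathcal S$ is the disjoint union of the three open cones $A_i=\{w_i+a(w_{i-1}-w_i)+b(w_i-w_{i+1}) : a,b>0\}$. For $\lambda\in(0,1)$ let $T=T_\lambda$ be the dissipative outer billiard map, $T(z)=-\lambda z+(1+\lambda)w_i$ for $z\in A_i$. A point $z\in X$ is non-singular if $T^n(z)\notin\mathcal S$ for every $n\ge 0$. A periodic orbit of $T$ is the orbit of a non-singular point $z$ with $T^p(z)=z$ for some $p\ge 1$, and its period is the least such $p$. Let $\lambda_n$ ($n\ge 1$) be the unique root in $[0,1)$ of $x^{2n}-x^{n}-x^{n-1}+1$, and let $\gamma_n$ ($n\ge 0$) be the unique root in $[0,1)$ of $x^{4n+4}-x^{3n+3}+x^{2n+2}-x^{2n+1}-x^{n+1}+1$. For $\lambda\in(0,1)$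 put $$m_1(\lambda)=\max\{n\ge 1:\lambda_{2n-1}<\lambda\le\lambda_{2n+1}\},\qquad m_2(\lambda)=\max\{n\ge 1:\gamma_{2n-1}<\lambda\le\gamma_{2n+1}\},$$ where $\max\emptyset=0$ (so $m_2(\lambda)=0$ when $\lambda\le\gamma_1$). Theorem. For every $\lambda\in(0,1)$ the periodic orbits of $T$ are exactly $m_1(\lambda)+m_2(\lambda)$ distinct orbits $\Gamma_{1,i}$, $1\le i\le m_1(\lambda)$, and $\Gamma_{2,i}$, $1\le i\le m_2(\lambda)$, where $\Gamma_{1,i}$ has period $3(2i-1)$ and $\Gamma_{2,i}$ has period $12i$. Moreover, for every non-singular $z\in X$ there exist $i\in\{1,2\}$ and $1\le j\le m_i(\lambda)$ such that $\operatorname{dist}(T^n(z),\Gamma_{i,j})\to 0$ as $n\to+\infty$, where $\operatorname{dist}$ is the Euclidean distance. In particular, $T$ is asymptotically periodic: the union of the $\omega$-limit sets of all non-singular points is the union of finitely many periodic orbits, and the forward orbit of every non-singular point converges to one of them. -/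

import Mathlib

open Filter Topology

noncomputable section

namespace TriangleBilliard

/-! ### The dissipative outer billiard about the equilateral triangle -/

/-- The primitive cube root of unity `v = exp (2 π i / 3)`. -/
def v : ℂ := Complex.exp (2 * Real.pi / 3 * Complex.I)

/-- The corners `0, -v, 1` of the equilateral triangle with unit side length, in anticlockwise
order. The indices are read cyclically in `Fin 3`. -/
def corner : Fin 3 → ℂ := ![0, -v, 1]

/-- The (closed, solid) triangle. -/
def triangle : Set ℂ := convexHull ℝ (Set.range corner)

/-- The phase space `X`, the complement of the triangle. -/
def X : Set ℂ := triangleᶜ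

/-- The singular set: the points outside the triangle that lie on one of the three half-lines
which start at a corner, contain a side, and leave that side through the corner `corner i`. -/
def singularSet : Set ℂ :=
  {z | z ∈ X ∧ ∃ (i : Fin 3) (t : ℝ), 0 ≤ t ∧
    z = corner (i + 1) + t * (corner i - corner (i + 1))}

/-- The open cone `A i` with apex `corner i`: the points whose right tangent ray to the triangle
touches it exactly at `corner i`. For `i = 0` it is `{a + b v | a > 0, b > 0}`. -/
def cone (i : Fin 3) : Set ℂ :=
  {z | ∃ a b : ℝ, 0 < a ∧ 0 < b ∧
    z = corner i + a * (corner (i - 1) - corner i) + b * (corner i - corner (i + 1))}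

open Classical in
/-- The dissipative outer billiard map with contraction rate `r`:
`z ↦ - r z + (1 + r) (corner i)` on `A i`. Outside the three cones, where the map is not defined,
the value is a placeholder; it is never used for non-singular points. -/
def T (r : ℝ) (z : ℂ) : ℂ :=
  if z ∈ cone 0 then -r * z + (1 + r) * corner 0
  else if z ∈ cone 1 then -r * z + (1 + r) * corner 1
  else if z ∈ cone 2 then -r * z + (1 + r) * corner 2
  else z

/-- A point of `X` is non-singular if its forward orbit never meets the singular set. -/
def NonSingular (r : ℝ) (z : ℂ) : Prop :=
  z ∈ X ∧ ∀ n : ℕ, (T r)^[n] z ∉ singularSet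

/-- `Γ` is a periodic orbit of `T r` whose (least) period is `p`. All the points of a periodic
orbit are points at which every iterate of the billiard map is defined. -/
def IsPeriodicOrbit (r : ℝ) (p : ℕ) (Γ : Set ℂ) : Prop :=
  ∃ z : ℂ, NonSingular r z ∧ 0 < p ∧ Function.minimalPeriod (T r) z = p ∧
    Γ = Set.range (fun n : ℕ => (T r)^[n] z)

/-- The forward orbit of `z` converges to the set `Γ`: the Euclidean distance between
`T^n z` and `Γ` tends to `0`. -/
def OrbitTendsto (r : ℝ) (z : ℂ) (Γ : Set ℂ) : Prop :=
  Tendsto (fun n : ℕ => Metric.infDist ((T r)^[n] z) Γ) atTop (𝓝 0)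

/-- The `ω`-limit set of the map: the union of the `ω`-limit sets of the non-singular points. -/
def omegaSet (r : ℝ) : Set ℂ :=
  ⋃ z ∈ {z : ℂ | NonSingular r z}, omegaLimit atTop (fun (n : ℕ) (x : ℂ) => (T r)^[n] x) {z}

/-- Asymptotic periodicity: the `ω`-limit set is the union of finitely many periodic orbits, and
the forward orbit of every non-singular point converges to one of them. -/
def AsymptoticallyPeriodic (r : ℝ) : Prop :=
  ∃ 𝒢 : Set (Set ℂ), 𝒢.Finite ∧ (∀ Γ ∈ 𝒢, ∃ p : ℕ, IsPeriodicOrbit r p Γ) ∧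
    omegaSet r = ⋃₀ 𝒢 ∧ ∀ z : ℂ, NonSingular r z → ∃ Γ ∈ 𝒢, OrbitTendsto r z Γ

/-! ### The bifurcation thresholds -/

/-- The polynomial `x^(2n) - x^n - x^(n-1) + 1`, for `n ≥ 1`. -/
def lambdaPoly (n : ℕ) (x : ℝ) : ℝ := x ^ (2 * n) - x ^ n - x ^ (n - 1) + 1

/-- The polynomial `x^(4n+4) - x^(3n+3) + x^(2n+2) - x^(2n+1) - x^(n+1) + 1`, for `n ≥ 0`. -/
def gammaPoly (n : ℕ) (x : ℝ) : ℝ :=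
  x ^ (4 * n + 4) - x ^ (3 * n + 3) + x ^ (2 * n + 2) - x ^ (2 * n + 1) - x ^ (n + 1) + 1

/-- The threshold `λ_n`, `n ≥ 1`: the unique root in `[0, 1)` of `lambdaPoly n`
(uniqueness is `lambdaPoly_eq_zero_iff`). -/
def lambdaThreshold (n : ℕ) : ℝ := sSup {x | x ∈ Set.Ico (0 : ℝ) 1 ∧ lambdaPoly n x = 0}

/-- The threshold `γ_n`, `n ≥ 0`: the unique root in `[0, 1)` of `gammaPoly n`
(uniqueness is `gammaPoly_eq_zero_iff`). -/
def gammaThreshold (n : ℕ) : ℝ := sSup {x | x ∈ Set.Ico (0 : ℝ) 1 ∧ gammaPoly n x = 0}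

/-- `m₁(r) = max {n ≥ 1 | λ_{2n-1} < r ≤ λ_{2n+1}}`. -/
def m₁ (r : ℝ) : ℕ :=
  sSup {n : ℕ | 1 ≤ n ∧ lambdaThreshold (2 * n - 1) < r ∧ r ≤ lambdaThreshold (2 * n + 1)}

/-- `m₂(r) = max {n ≥ 1 | γ_{2n-1} < r ≤ γ_{2n+1}}`, with `max ∅ = 0` (the case `r ≤ γ_1`). -/
def m₂ (r : ℝ) : ℕ :=
  sSup {n : ℕ | 1 ≤ n ∧ gammaThreshold (2 * n - 1) < r ∧ r ≤ gammaThreshold (2 * n + 1)}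

theorem existsUnique_sum_pow_eq (s t : Finset ℕ) (m : ℕ) (ht : ∀ i ∈ t, i ≤ m)
    (hs : ∀ j ∈ s, m < j) (h0 : 0 ∈ t) (hc : t.card < s.card) :
    ∃! x : ℝ, x ∈ Set.Ico (0 : ℝ) 1 ∧ ∑ k ∈ s, x ^ k - ∑ k ∈ t, x ^ k = 0 := by
  have hsne : s.Nonempty := Finset.card_pos.mp (by omega)
  have hzero : ∑ k ∈ s, (0 : ℝ) ^ k - ∑ k ∈ t, (0 : ℝ) ^ k = -1 := by
    have h1 : ∑ k ∈ s, (0 : ℝ) ^ k = 0 :=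
      Finset.sum_eq_zero fun k hk => zero_pow (by have := hs k hk; omega)
    have h2 : ∑ k ∈ t, (0 : ℝ) ^ k = 1 := by
      rw [Finset.sum_eq_single 0 (fun k _ hk => zero_pow hk) (fun h => absurd h0 h)]
      simp
    rw [h1, h2]; norm_num
  have hone : 0 < ∑ k ∈ s, (1 : ℝ) ^ k - ∑ k ∈ t, (1 : ℝ) ^ k := by
    simp only [one_pow, Finset.sum_const, nsmul_eq_mul, mul_one, sub_pos]
    exact_mod_cast hc
  have hcont : ContinuousOn (fun x : ℝ => ∑ k ∈ s, x ^ k - ∑ k ∈ t, x ^ k) (Set.Icc 0 1) := by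
    fun_prop
  have huniq : ∀ x y : ℝ, 0 < x → x < y →
      ∑ k ∈ s, x ^ k - ∑ k ∈ t, x ^ k = 0 → ∑ k ∈ s, y ^ k - ∑ k ∈ t, y ^ k = 0 → False := by
    intro x y hx hxy ex ey
    have hy : 0 < y := hx.trans hxy
    have h1 : y ^ m * ∑ k ∈ s, x ^ k < x ^ m * ∑ k ∈ s, y ^ k := by
      rw [Finset.mul_sum, Finset.mul_sum]
      refine Finset.sum_lt_sum_of_nonempty hsne fun j hj => ?_
      obtain ⟨d, rfl⟩ := Nat.exists_eq_add_of_lt (hs j hj)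
      have hd : x ^ (d + 1) < y ^ (d + 1) := pow_lt_pow_left₀ hxy hx.le (by omega)
      have := mul_lt_mul_of_pos_left hd (mul_pos (pow_pos hy m) (pow_pos hx m))
      calc y ^ m * x ^ (m + d + 1) = y ^ m * x ^ m * x ^ (d + 1) := by ring
        _ < y ^ m * x ^ m * y ^ (d + 1) := this
        _ = x ^ m * y ^ (m + d + 1) := by ring
    have h2 : x ^ m * ∑ k ∈ t, y ^ k ≤ y ^ m * ∑ k ∈ t, x ^ k := by
      rw [Finset.mul_sum, Finset.mul_sum]
      refine Finset.sum_le_sum fun i hi => ?_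
      obtain ⟨d, rfl⟩ := Nat.exists_eq_add_of_le (ht i hi)
      have hd : x ^ d ≤ y ^ d := pow_le_pow_left₀ hx.le hxy.le d
      have := mul_le_mul_of_nonneg_left hd (mul_pos (pow_pos hy i) (pow_pos hx i)).le
      calc x ^ (i + d) * y ^ i = y ^ i * x ^ i * x ^ d := by ring
        _ ≤ y ^ i * x ^ i * y ^ d := this
        _ = y ^ (i + d) * x ^ i := by ring
    rw [sub_eq_zero.mp ex, sub_eq_zero.mp ey] at h1
    exact absurd h1 (not_lt.mpr h2)
  obtain ⟨x, hx, hfx⟩ := intermediate_value_Icc zero_le_one hcont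
    (show (0 : ℝ) ∈ Set.Icc _ _ from ⟨by simp only [hzero]; norm_num, hone.le⟩)
  have hx1 : x ≠ 1 := by rintro rfl; exact hone.ne' hfx
  refine ⟨x, ⟨⟨hx.1, lt_of_le_of_ne hx.2 hx1⟩, hfx⟩, ?_⟩
  have hpos : ∀ z : ℝ, 0 ≤ z → ∑ k ∈ s, z ^ k - ∑ k ∈ t, z ^ k = 0 → 0 < z := by
    intro z hz ez
    refine lt_of_le_of_ne hz ?_
    rintro rfl
    rw [hzero] at ez
    norm_num at ez
  rintro y ⟨hy, ey⟩
  rcases lt_trichotomy y x with h | h | h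
  · exact (huniq y x (hpos y hy.1 ey) h ey hfx).elim
  · exact h
  · exact (huniq x y (hpos x hx.1 hfx) h hfx ey).elim

theorem lambdaPoly_eq (n : ℕ) (hn : 2 ≤ n) (x : ℝ) :
    lambdaPoly n x =
      (x - 1) * (∑ k ∈ Finset.Ico n (2 * n), x ^ k - ∑ k ∈ Finset.range (n - 1), x ^ k) := by
  have h1 := geom_sum_Ico_mul x (show n ≤ 2 * n by omega)
  have h2 := geom_sum_mul x (n - 1)
  unfold lambdaPoly
  linear_combination h2 - h1

theorem gammaPoly_eq (n : ℕ) (x : ℝ) :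
    gammaPoly n x =
      (x - 1) * (∑ k ∈ insert (2 * n + 1) (Finset.Ico (3 * n + 3) (4 * n + 4)), x ^ k
        - ∑ k ∈ Finset.range (n + 1), x ^ k) := by
  have h1 := geom_sum_Ico_mul x (show 3 * n + 3 ≤ 4 * n + 4 by omega)
  have h2 := geom_sum_mul x (n + 1)
  rw [Finset.sum_insert (by simp only [Finset.mem_Ico]; omega)]
  unfold gammaPoly
  linear_combination h2 - h1

theorem existsUnique_lambdaPoly (n : ℕ) (hn : 1 ≤ n) :
    ∃! x : ℝ, x ∈ Set.Ico (0 : ℝ) 1 ∧ lambdaPoly n x = 0 := by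
  rcases Nat.lt_or_ge n 2 with h | h
  · obtain rfl : n = 1 := by omega
    refine ⟨0, ⟨⟨le_rfl, zero_lt_one⟩, by norm_num [lambdaPoly]⟩, ?_⟩
    rintro y ⟨hy, ey⟩
    have : y * (y - 1) = 0 := by
      rw [← ey]; unfold lambdaPoly; ring
    rcases mul_eq_zero.mp this with h | h
    · exact h
    · have := hy.2
      linarith
  · have key := existsUnique_sum_pow_eq (Finset.Ico n (2 * n)) (Finset.range (n - 1)) (n - 1)
      (fun i hi => by simp at hi; omega) (fun j hj => by simp at hj; omega)
      (by simp; omega) (by simp; omega)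
    refine (existsUnique_congr fun x => ?_).mp key
    refine and_congr_right fun hx => ?_
    rw [lambdaPoly_eq n h, mul_eq_zero, or_iff_right (sub_ne_zero.mpr hx.2.ne)]

theorem existsUnique_gammaPoly (n : ℕ) :
    ∃! x : ℝ, x ∈ Set.Ico (0 : ℝ) 1 ∧ gammaPoly n x = 0 := by
  have key := existsUnique_sum_pow_eq (insert (2 * n + 1) (Finset.Ico (3 * n + 3) (4 * n + 4)))
    (Finset.range (n + 1)) n
    (fun i hi => by simp at hi; omega) (fun j hj => by simp at hj; omega)
    (by simp) (by
      rw [Finset.card_insert_of_notMem (by simp only [Finset.mem_Ico]; omega)]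
      simp; omega)
  refine (existsUnique_congr fun x => ?_).mp key
  refine and_congr_right fun hx => ?_
  rw [gammaPoly_eq n, mul_eq_zero, or_iff_right (sub_ne_zero.mpr hx.2.ne)]

/-- `lambdaThreshold n` is the unique root of `lambdaPoly n` in `[0, 1)`. -/
theorem lambdaPoly_eq_zero_iff (n : ℕ) (hn : 1 ≤ n) (x : ℝ) :
    (x ∈ Set.Ico (0 : ℝ) 1 ∧ lambdaPoly n x = 0) ↔ x = lambdaThreshold n := by
  obtain ⟨y, hy, hu⟩ := existsUnique_lambdaPoly n hn
  have hset : {x | x ∈ Set.Ico (0 : ℝ) 1 ∧ lambdaPoly n x = 0} = {y} :=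
    Set.ext fun z => ⟨fun hz => hu z hz, fun hz => by rw [Set.mem_singleton_iff.mp hz]; exact hy⟩
  rw [lambdaThreshold, hset, csSup_singleton]
  exact ⟨fun hz => hu x hz, fun hz => hz ▸ hy⟩

/-- `gammaThreshold n` is the unique root of `gammaPoly n` in `[0, 1)`. -/
theorem gammaPoly_eq_zero_iff (n : ℕ) (x : ℝ) :
    (x ∈ Set.Ico (0 : ℝ) 1 ∧ gammaPoly n x = 0) ↔ x = gammaThreshold n := by
  obtain ⟨y, hy, hu⟩ := existsUnique_gammaPoly n
  have hset : {x | x ∈ Set.Ico (0 : ℝ) 1 ∧ gammaPoly n x = 0} = {y} :=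
    Set.ext fun z => ⟨fun hz => hu z hz, fun hz => by rw [Set.mem_singleton_iff.mp hz]; exact hy⟩
  rw [gammaThreshold, hset, csSup_singleton]
  exact ⟨fun hz => hu x hz, fun hz => hz ▸ hy⟩

end TriangleBilliard

end

noncomputable section

namespace TriangleBilliard

/-! ### Coordinates in the basis `1, v` -/

/-! In the normalised coordinates `A`, `B`, `C = B - A` the map is `step`. If `r C < 1`, the orbit
enters the next cone with `(A, B, C)` replaced by `(1 - r C, 1 + r A, r B)`; if `r C > 1`, the
previous cone with `(r (B - 1), r C, r (1 - A))`; if `r C = 1`, the image is singular. A forward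
step followed by a backward one scales `A` and `B` by `r ^ 2`. So from `r C < 1` the orbit
oscillates between two cones for `2 k + 1` steps, `k` least with `r ^ (2 k + 2) B ≤ 1`, and ends in
the next cone at `(1 - ρ C, 1 + ρ A, ρ B)`, `ρ = r ^ (2 k + 1)`. This is `block`; at its end `r < C
≤ 1 / r`.

After the first block, successive indices satisfy `k_{n+1} ≤ k_n + 1` and `k_{n+2} ≤ k_n`
(`blockIndex_block_le`, `blockIndex_block_block_le`). Hence they end up alternating between two
values that are equal or consecutive (`BlockRegular.exists_alternates`). Along such a tail a
positive combination of three values of `C` is constant, and each exceeds `r`; the resulting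
inequality (`Alternates.lt`) says that `lambdaPoly` or `gammaPoly` is negative at `r`. Conversely,
that sign makes the explicit periodic solution of the recurrence a genuine orbit (`balanced_self`,
`balanced_succ`).

A non-singular orbit thus eventually visits the same cones as some periodic orbit. The map contracts
each cone by `r`, so their distance decays like `r ^ n` (`NonSingular.exists_dist_eq`), and a
periodic point must lie on that orbit. Each block advances the cone by one, so a period consists of
3 blocks (equal indices) or 6 (distinct ones). The orbits are told apart by their periods, and
monotonicity of the polynomials in `n` makes `m₁`, `m₂` count them. -/

theorem v_eq : v = ⟨-1 / 2, √3 / 2⟩ := by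
  have h : 2 * Real.pi / 3 = Real.pi - Real.pi / 3 := by ring
  have e : v = Complex.exp (((2 * Real.pi / 3 : ℝ) : ℂ) * Complex.I) := by
    unfold v; push_cast; rfl
  rw [e]
  apply Complex.ext
  · rw [Complex.exp_ofReal_mul_I_re, h, Real.cos_pi_sub, Real.cos_pi_div_three]; norm_num
  · rw [Complex.exp_ofReal_mul_I_im, h, Real.sin_pi_sub, Real.sin_pi_div_three]

/-- The point with coordinates `x, y` in the basis `1, v` of `ℂ` over `ℝ`. -/
def coord (x y : ℝ) : ℂ := x + y * v

theorem coord_re (x y : ℝ) : (coord x y).re = x - y / 2 := by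
  simp [coord, v_eq]; ring

theorem coord_im (x y : ℝ) : (coord x y).im = y * (√3 / 2) := by
  simp [coord, v_eq]

theorem coord_inj {x y x' y' : ℝ} : coord x y = coord x' y' ↔ x = x' ∧ y = y' := by
  refine ⟨fun h => ?_, by rintro ⟨rfl, rfl⟩; rfl⟩
  have h1 := congrArg Complex.re h
  have h2 := congrArg Complex.im h
  rw [coord_re, coord_re] at h1
  rw [coord_im, coord_im] at h2
  have : y = y' := mul_right_cancel₀ (by positivity) h2
  subst this
  exact ⟨by linarith, rfl⟩

theorem exists_coord (z : ℂ) : ∃ x y : ℝ, z = coord x y := by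
  refine ⟨z.re + z.im / √3, z.im / (√3 / 2), Complex.ext ?_ ?_⟩
  · rw [coord_re]; field_simp; ring
  · rw [coord_im]; field_simp

theorem v_sq : v ^ 2 = -1 - v := by
  have h3 : √3 * √3 = 3 := Real.mul_self_sqrt (by norm_num)
  apply Complex.ext
  · simp [v_eq, pow_two]; linarith
  · simp [v_eq, pow_two]; ring

theorem corner_zero : corner 0 = coord 0 0 := by simp [corner, coord]
theorem corner_one : corner 1 = coord 0 (-1) := by simp [corner, coord]
theorem corner_two : corner 2 = coord 1 0 := by simp [corner, coord]

theorem mem_cone_zero (x y : ℝ) : coord x y ∈ cone 0 ↔ 0 < x ∧ 0 < y := by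
  have key : ∀ a b : ℝ, corner 0 + a * (corner (0 - 1) - corner 0)
      + b * (corner 0 - corner (0 + 1)) = coord a b := fun a b => by
    rw [show (0 - 1 : Fin 3) = 2 from rfl, show (0 + 1 : Fin 3) = 1 from rfl,
      corner_zero, corner_one, corner_two]
    simp [coord]
  simp only [cone, Set.mem_ofPred_eq, key, coord_inj]
  constructor
  · rintro ⟨a, b, ha, hb, rfl, rfl⟩; exact ⟨ha, hb⟩
  · rintro ⟨ha, hb⟩; exact ⟨x, y, ha, hb, rfl, rfl⟩

theorem mem_cone_one (x y : ℝ) : coord x y ∈ cone 1 ↔ x < 0 ∧ 0 < 1 - x + y := by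
  have key : ∀ a b : ℝ, corner 1 + a * (corner (1 - 1) - corner 1)
      + b * (corner 1 - corner (1 + 1)) = coord (-b) (a - b - 1) := fun a b => by
    rw [show (1 - 1 : Fin 3) = 0 from rfl, show (1 + 1 : Fin 3) = 2 from rfl,
      corner_zero, corner_one, corner_two]
    simp [coord]; ring
  simp only [cone, Set.mem_ofPred_eq, key, coord_inj]
  constructor
  · rintro ⟨a, b, ha, hb, rfl, rfl⟩; constructor <;> linarith
  · rintro ⟨h1, h2⟩; exact ⟨1 - x + y, -x, h2, by linarith, by ring, by ring⟩

theorem mem_cone_two (x y : ℝ) : coord x y ∈ cone 2 ↔ y < 0 ∧ 1 - x + y < 0 := by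
  have key : ∀ a b : ℝ, corner 2 + a * (corner (2 - 1) - corner 2)
      + b * (corner 2 - corner (2 + 1)) = coord (1 - a + b) (-a) := fun a b => by
    rw [show (2 - 1 : Fin 3) = 1 from rfl, show (2 + 1 : Fin 3) = 0 from rfl,
      corner_zero, corner_one, corner_two]
    simp [coord]; ring
  simp only [cone, Set.mem_ofPred_eq, key, coord_inj]
  constructor
  · rintro ⟨a, b, ha, hb, rfl, rfl⟩; constructor <;> linarith
  · rintro ⟨h1, h2⟩; exact ⟨-y, x - y - 1, by linarith, by linarith, by ring, by ring⟩

theorem mem_triangle (x y : ℝ) : coord x y ∈ triangle ↔ 0 ≤ x ∧ y ≤ 0 ∧ 0 ≤ 1 - x + y := by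
  have hr : Set.range corner = {coord 0 0, coord 0 (-1), coord 1 0} := by
    ext z
    simp only [Set.mem_range, Fin.exists_fin_succ, Set.mem_insert_iff, Set.mem_singleton_iff]
    simp [corner, coord, eq_comm]
  rw [triangle, hr, convexHull_insert (by simp), convexHull_pair]
  simp only [mem_convexJoin, Set.mem_singleton_iff, exists_eq_left, segment, Set.mem_ofPred_eq]
  constructor
  · rintro ⟨_, ⟨a, b, ha, hb, hab, rfl⟩, c, d, hc, hd, hcd, h⟩
    have : coord x y = coord (d * b) (-(d * a)) := by
      rw [← h]; simp [coord]; ring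
    obtain ⟨rfl, rfl⟩ := coord_inj.mp this
    refine ⟨by positivity, by have := mul_nonneg hd ha; linarith, ?_⟩
    have : d * a + d * b = d := by rw [← mul_add, hab, mul_one]
    linarith
  · rintro ⟨hx, hy, hxy⟩
    -- Here `x - y` is the weight of the opposite side in the join with corner `0`; it vanishes only
    -- at that corner.
    rcases eq_or_lt_of_le (show 0 ≤ x - y by linarith) with h | h
    · obtain rfl : x = 0 := by linarith
      obtain rfl : y = 0 := by linarith
      exact ⟨_, ⟨1, 0, by norm_num, le_rfl, by norm_num, rfl⟩, 1, 0, by norm_num, le_rfl,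
        by norm_num, by simp⟩
    · refine ⟨_, ⟨-y / (x - y), x / (x - y), div_nonneg (by linarith) h.le,
        div_nonneg hx h.le, by field_simp; ring, rfl⟩, 1 - x + y, x - y, hxy, h.le, by ring, ?_⟩
      have hc : (x - y : ℂ) ≠ 0 := by exact_mod_cast h.ne'
      simp [coord]
      field_simp
      ring

theorem mem_X (x y : ℝ) : coord x y ∈ X ↔ x < 0 ∨ 0 < y ∨ 1 - x + y < 0 := by
  rw [X, Set.mem_compl_iff, mem_triangle]
  grind

theorem mem_singularSet (x y : ℝ) : coord x y ∈ singularSet ↔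
    (x = 0 ∧ 0 < y) ∨ (1 - x + y = 0 ∧ x < 0) ∨ (y = 0 ∧ 1 < x) := by
  have k0 : ∀ t : ℝ, corner (0 + 1) + t * (corner 0 - corner (0 + 1)) = coord 0 (t - 1) := by
    intro t
    rw [show (0 + 1 : Fin 3) = 1 from rfl, corner_zero, corner_one]
    simp [coord]; ring
  have k1 : ∀ t : ℝ, corner (1 + 1) + t * (corner 1 - corner (1 + 1)) = coord (1 - t) (-t) := by
    intro t
    rw [show (1 + 1 : Fin 3) = 2 from rfl, corner_two, corner_one]
    simp [coord]; ring
  have k2 : ∀ t : ℝ, corner (2 + 1) + t * (corner 2 - corner (2 + 1)) = coord t 0 := by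
    intro t
    rw [show (2 + 1 : Fin 3) = 0 from rfl, corner_two, corner_zero]
    simp [coord]
  simp only [singularSet, Set.mem_ofPred_eq, mem_X]
  constructor
  · rintro ⟨hX, i, t, ht, h⟩
    fin_cases i
    · obtain ⟨rfl, rfl⟩ := coord_inj.mp (h.trans (k0 t)); grind
    · obtain ⟨rfl, rfl⟩ := coord_inj.mp (h.trans (k1 t)); grind
    · obtain ⟨rfl, rfl⟩ := coord_inj.mp (h.trans (k2 t)); grind
  · rintro (⟨rfl, h⟩ | ⟨h1, h⟩ | ⟨rfl, h⟩)
    · exact ⟨by grind, 0, y + 1, by linarith, by rw [k0]; congr; ring⟩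
    · exact ⟨by grind, 1, -y, by linarith, by rw [k1, coord_inj]; constructor <;> linarith⟩
    · exact ⟨by grind, 2, x, by linarith, by rw [k2]⟩

theorem T_coord_zero (r : ℝ) {x y : ℝ} (hx : 0 < x) (hy : 0 < y) :
    T r (coord x y) = coord (-r * x) (-r * y) := by
  rw [T, if_pos ((mem_cone_zero x y).2 ⟨hx, hy⟩), corner_zero]
  simp [coord]; ring

theorem T_coord_one (r : ℝ) {x y : ℝ} (hx : x < 0) (hy : 0 < 1 - x + y) :
    T r (coord x y) = coord (-r * x) (-r * y - 1 - r) := by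
  rw [T, if_neg (by rw [mem_cone_zero]; grind), if_pos ((mem_cone_one x y).2 ⟨hx, hy⟩), corner_one]
  simp [coord]; ring

theorem T_coord_two (r : ℝ) {x y : ℝ} (hy : y < 0) (hx : 1 - x + y < 0) :
    T r (coord x y) = coord (-r * x + 1 + r) (-r * y) := by
  rw [T, if_neg (by rw [mem_cone_zero]; grind), if_neg (by rw [mem_cone_one]; grind),
    if_pos ((mem_cone_two x y).2 ⟨hy, hx⟩), corner_two]
  simp [coord]; ring

/-! ### The billiard map in normalised cone coordinates

A point `corner i + a (corner (i - 1) - corner i) + b (corner i - corner (i + 1))` of the cone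
`A i` is encoded by `i`, `A = (1 - r) a` and `B = (1 - r) b + 1`. -/

/-- A cone index together with the normalised coordinates `A`, `B`. -/
abbrev State := Fin 3 × ℝ × ℝ

/-- The third normalised coordinate, `C = B - A`. -/
def thd (s : State) : ℝ := s.2.2 - s.2.1

/-- The point of the plane encoded by a state. -/
def point (r : ℝ) (s : State) : ℂ :=
  ![coord (s.2.1 / (1 - r)) ((s.2.2 - 1) / (1 - r)),
    coord (-((s.2.2 - 1) / (1 - r))) (s.2.1 / (1 - r) - (s.2.2 - 1) / (1 - r) - 1),
    coord (1 - s.2.1 / (1 - r) + (s.2.2 - 1) / (1 - r)) (-(s.2.1 / (1 - r)))] s.1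

/-- The billiard map on states. -/
def step (r : ℝ) (s : State) : State :=
  if r * thd s < 1 then (s.1 + 1, 1 - r * thd s, 1 + r * s.2.1)
  else (s.1 + 2, r * (s.2.2 - 1), r * thd s)

/-- The state encodes a point of the open cone. -/
def Pos (s : State) : Prop := 0 < s.2.1 ∧ 1 < s.2.2

/-- The state encodes a non-singular point. -/
def Regular (r : ℝ) (s : State) : Prop := Pos s ∧ ∀ n : ℕ, r * thd ((step r)^[n] s) ≠ 1

variable {r : ℝ}

theorem step_of_lt {s : State} (h : r * thd s < 1) :
    step r s = (s.1 + 1, 1 - r * thd s, 1 + r * s.2.1) := if_pos h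

theorem step_of_gt {s : State} (h : 1 < r * thd s) :
    step r s = (s.1 + 2, r * (s.2.2 - 1), r * thd s) := if_neg h.not_gt

theorem Pos.step (hr0 : 0 < r) {s : State} (hs : Pos s) (h : r * thd s ≠ 1) :
    Pos (step r s) := by
  obtain ⟨hA, hB⟩ := hs
  rcases lt_or_gt_of_ne h with h | h
  · rw [step_of_lt h]
    have := mul_pos hr0 hA
    constructor <;> simp only <;> linarith
  · rw [step_of_gt h]
    exact ⟨mul_pos hr0 (by linarith), h⟩

theorem Regular.step (hr0 : 0 < r) {s : State} (hs : Regular r s) : Regular r (step r s) :=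
  ⟨hs.1.step hr0 (hs.2 0), fun n => hs.2 (n + 1)⟩

theorem Regular.iterate (hr0 : 0 < r) {s : State} (hs : Regular r s) (n : ℕ) :
    Regular r ((TriangleBilliard.step r)^[n] s) := by
  induction n with
  | zero => exact hs
  | succ n ih => rw [Function.iterate_succ_apply']; exact ih.step hr0

/-- The point of the plane with cone index `i` and unnormalised cone coordinates `a`, `b`. -/
def conePoint (i : Fin 3) (a b : ℝ) : ℂ :=
  ![coord a b, coord (-b) (a - b - 1), coord (1 - a + b) (-a)] i

theorem point_mk (hr1 : r < 1) (i : Fin 3) (a b : ℝ) :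
    point r (i, (1 - r) * a, (1 - r) * b + 1) = conePoint i a b := by
  have hq : 1 - r ≠ 0 := by linarith
  simp [point, conePoint, hq]

theorem exists_mk (hr1 : r < 1) {s : State} (hs : Pos s) :
    ∃ (i : Fin 3) (a b : ℝ), 0 < a ∧ 0 < b ∧ s = (i, (1 - r) * a, (1 - r) * b + 1) := by
  obtain ⟨i, A, B⟩ := s
  have hq : 0 < 1 - r := by linarith
  refine ⟨i, A / (1 - r), (B - 1) / (1 - r), div_pos hs.1 hq, div_pos (sub_pos.2 hs.2) hq, ?_⟩
  field_simp
  simp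

theorem exists_point (hr1 : r < 1) {z : ℂ} (hX : z ∈ X) (hS : z ∉ singularSet) :
    ∃ s, Pos s ∧ point r s = z := by
  obtain ⟨x, y, rfl⟩ := exists_coord z
  rw [mem_X] at hX
  rw [mem_singularSet] at hS
  have hq : 0 < 1 - r := by linarith
  have key : ∀ (i : Fin 3) (a b : ℝ), 0 < a → 0 < b →
      ∃ s, Pos s ∧ point r s = conePoint i a b := fun i a b ha hb =>
    ⟨_, ⟨mul_pos hq ha, by have := mul_pos hq hb; simp only; linarith⟩, point_mk hr1 i a b⟩
  have hcases : (0 < x ∧ 0 < y) ∨ (x < 0 ∧ 0 < 1 - x + y) ∨ (y < 0 ∧ 1 - x + y < 0) := by grind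
  rcases hcases with ⟨h1, h2⟩ | ⟨h1, h2⟩ | ⟨h1, h2⟩
  · exact key 0 x y h1 h2
  · convert key 1 (1 - x + y) (-x) h2 (by linarith) using 4
    simp only [conePoint, Matrix.cons_val, coord_inj]
    constructor <;> ring
  · convert key 2 (-y) (x - y - 1) (by linarith) (by linarith) using 4
    simp only [conePoint, Matrix.cons_val, coord_inj]
    constructor <;> ring

theorem point_mem_X (hr1 : r < 1) {s : State} (hs : Pos s) :
    point r s ∈ X ∧ point r s ∉ singularSet := by
  obtain ⟨i, a, b, ha, hb, rfl⟩ := exists_mk hr1 hs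
  rw [point_mk hr1]
  fin_cases i <;> simp [conePoint, mem_X, mem_singularSet] <;> grind

theorem point_injective (hr1 : r < 1) {s t : State} (hs : Pos s) (ht : Pos t)
    (h : point r s = point r t) : s = t := by
  obtain ⟨i, a, b, ha, hb, rfl⟩ := exists_mk hr1 hs
  obtain ⟨j, a', b', ha', hb', rfl⟩ := exists_mk hr1 ht
  rw [point_mk hr1, point_mk hr1] at h
  have : i = j ∧ a = a' ∧ b = b' := by
    fin_cases i <;> fin_cases j <;> simp [conePoint, coord_inj] at h ⊢ <;> grind
  obtain ⟨rfl, rfl, rfl⟩ := this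
  rfl

/-- The same image is expressed in the coordinates of both candidate cones; which of them contains
it is decided later by the sign of `r b - r a - 1`. -/
theorem T_conePoint (r : ℝ) (i : Fin 3) {a b : ℝ} (ha : 0 < a) (hb : 0 < b) :
    T r (conePoint i a b) = conePoint (i + 1) (1 + r * a - r * b) (r * a) ∧
    T r (conePoint i a b) = conePoint (i + 2) (r * b) (r * b - r * a - 1) := by
  fin_cases i
  · simp [conePoint, T_coord_zero r ha hb, coord_inj]
    ring_nf
  · simp [conePoint, T_coord_one r (show -b < 0 by linarith) (show 0 < 1 - -b + (a - b - 1) by linarith),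
      coord_inj]
    ring_nf; simp
  · simp [conePoint, T_coord_two r (show -a < 0 by linarith)
      (show 1 - (1 - a + b) + -a < 0 by linarith), coord_inj]
    ring_nf; simp

theorem thd_mk (i : Fin 3) (a b : ℝ) :
    thd (i, (1 - r) * a, (1 - r) * b + 1) = (1 - r) * (b - a) + 1 := by
  simp only [thd]; ring

theorem T_point (hr1 : r < 1) {s : State} (hs : Pos s) (h : r * thd s ≠ 1) :
    T r (point r s) = point r (step r s) := by
  obtain ⟨i, a, b, ha, hb, rfl⟩ := exists_mk hr1 hs
  rw [point_mk hr1]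
  rcases lt_or_gt_of_ne h with h | h
  · rw [step_of_lt h, (T_conePoint r i ha hb).1, ← point_mk hr1, thd_mk]
    ring_nf
  · rw [step_of_gt h, (T_conePoint r i ha hb).2, ← point_mk hr1, thd_mk]
    ring_nf

/-- At `r C = 1` the first coordinate `1 + r a - r b` in the next cone vanishes, which puts the
image on a boundary ray. -/
theorem T_point_singular (hr0 : 0 < r) (hr1 : r < 1) {s : State} (hs : Pos s)
    (h : r * thd s = 1) : T r (point r s) ∈ singularSet := by
  obtain ⟨i, a, b, ha, hb, rfl⟩ := exists_mk hr1 hs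
  have h' : r * b = 1 + r * a := by
    have hq : 1 - r ≠ 0 := by linarith
    rw [thd_mk] at h
    apply mul_left_cancel₀ hq
    linarith
  have := mul_pos hr0 ha
  rw [point_mk hr1, (T_conePoint r i ha hb).1]
  fin_cases i <;> simp [conePoint, mem_singularSet] <;> grind

theorem Regular.iterate_T (hr0 : 0 < r) (hr1 : r < 1) {s : State} (hs : Regular r s) (n : ℕ) :
    (T r)^[n] (point r s) = point r ((TriangleBilliard.step r)^[n] s) := by
  induction n with
  | zero => rfl
  | succ n ih =>
    rw [Function.iterate_succ_apply', Function.iterate_succ_apply', ih,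
      T_point hr1 (hs.iterate hr0 n).1 (hs.2 n)]

theorem Regular.nonSingular (hr0 : 0 < r) (hr1 : r < 1) {s : State} (hs : Regular r s) :
    NonSingular r (point r s) :=
  ⟨(point_mem_X hr1 hs.1).1, fun n => by
    rw [hs.iterate_T hr0 hr1]; exact (point_mem_X hr1 (hs.iterate hr0 n).1).2⟩

theorem NonSingular.exists_regular (hr0 : 0 < r) (hr1 : r < 1) {z : ℂ} (hz : NonSingular r z) :
    ∃ s, Regular r s ∧ point r s = z := by
  obtain ⟨s, hs, rfl⟩ := exists_point hr1 hz.1 (hz.2 0)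
  refine ⟨s, ⟨hs, ?_⟩, rfl⟩
  have key : ∀ n, Pos ((step r)^[n] s) ∧ (T r)^[n] (point r s) = point r ((step r)^[n] s) := by
    intro n
    induction n with
    | zero => exact ⟨hs, rfl⟩
    | succ n ih =>
      have hne : r * thd ((step r)^[n] s) ≠ 1 := fun h => hz.2 (n + 1) <| by
        rw [Function.iterate_succ_apply', ih.2]; exact T_point_singular hr0 hr1 ih.1 h
      rw [Function.iterate_succ_apply', Function.iterate_succ_apply', ih.2]
      exact ⟨ih.1.step hr0 hne, T_point hr1 ih.1 hne⟩
  intro n h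
  refine hz.2 (n + 1) ?_
  rw [Function.iterate_succ_apply', (key n).2]
  exact T_point_singular hr0 hr1 (key n).1 h

/-- On a single cone the billiard map is a similarity with ratio `r`. -/
theorem dist_T_point (hr0 : 0 < r) (hr1 : r < 1) {s t : State} (hs : Pos s) (ht : Pos t)
    (h : s.1 = t.1) : dist (T r (point r s)) (T r (point r t)) = r * dist (point r s) (point r t) := by
  obtain ⟨i, a, b, ha, hb, rfl⟩ := exists_mk hr1 hs
  obtain ⟨j, a', b', ha', hb', rfl⟩ := exists_mk hr1 ht
  obtain rfl : i = j := h
  rw [point_mk hr1, point_mk hr1, (T_conePoint r i ha hb).1, (T_conePoint r i ha' hb').1,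
    dist_eq_norm, dist_eq_norm, ← Real.norm_of_nonneg hr0.le, ← Complex.norm_real,
    ← norm_mul, ← norm_neg, Complex.norm_real, Real.norm_of_nonneg hr0.le]
  congr 1
  have hv := v_sq
  fin_cases i <;> simp [conePoint, coord] <;> ring

/-- Equal itineraries let the contraction on single cones accumulate; all convergence comes from
here. -/
theorem dist_iterate (hr0 : 0 < r) (hr1 : r < 1) {s t : State} (hs : Regular r s)
    (ht : Regular r t) (h : ∀ n, ((step r)^[n] s).1 = ((step r)^[n] t).1) (n : ℕ) :
    dist ((T r)^[n] (point r s)) ((T r)^[n] (point r t)) =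
      r ^ n * dist (point r s) (point r t) := by
  induction n with
  | zero => simp
  | succ n ih =>
    rw [Function.iterate_succ_apply', Function.iterate_succ_apply', hs.iterate_T hr0 hr1,
      ht.iterate_T hr0 hr1, dist_T_point hr0 hr1 (hs.iterate hr0 n).1 (ht.iterate hr0 n).1 (h n),
      ← hs.iterate_T hr0 hr1, ← ht.iterate_T hr0 hr1, ih]
    ring

/-! ### Blocks -/

/-- The number of pairs of steps in the block that starts with second coordinate `B`. -/
def blockIndex (r B : ℝ) : ℕ := sInf {k : ℕ | r ^ (2 * k + 2) * B ≤ 1}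

/-- The state reached at the end of a block. -/
def block (r : ℝ) (s : State) : State :=
  (s.1 + 1, 1 - r ^ (2 * blockIndex r s.2.2 + 1) * thd s,
    1 + r ^ (2 * blockIndex r s.2.2 + 1) * s.2.1)

/-- The states at which a block may start. -/
def BlockStart (r : ℝ) (s : State) : Prop := Pos s ∧ r * thd s < 1

theorem blockIndex_spec (hr0 : 0 < r) (hr1 : r < 1) {B : ℝ} (hB : 1 < B) :
    r ^ (2 * blockIndex r B + 2) * B ≤ 1 ∧ 1 < r ^ (2 * blockIndex r B) * B := by
  have hne : {k : ℕ | r ^ (2 * k + 2) * B ≤ 1}.Nonempty := by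
    obtain ⟨n, hn⟩ := exists_pow_lt_of_lt_one (show (0 : ℝ) < 1 / B by positivity) hr1
    refine ⟨n, ?_⟩
    have h1 : r ^ (2 * n + 2) ≤ r ^ n := pow_le_pow_of_le_one hr0.le hr1.le (by omega)
    have := (lt_div_iff₀ (by linarith)).1 (h1.trans_lt hn)
    exact this.le
  refine ⟨Nat.sInf_mem hne, ?_⟩
  by_contra! h
  rcases Nat.eq_zero_or_pos (blockIndex r B) with h0 | h0
  · rw [h0] at h; simp at h; linarith
  · have : blockIndex r B ≤ blockIndex r B - 1 := Nat.sInf_le <| by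
      change r ^ (2 * (blockIndex r B - 1) + 2) * B ≤ 1
      rwa [show 2 * (blockIndex r B - 1) + 2 = 2 * blockIndex r B by omega]
    omega

theorem blockIndex_le {B : ℝ} {k : ℕ} (h : r ^ (2 * k + 2) * B ≤ 1) : blockIndex r B ≤ k :=
  Nat.sInf_le h

theorem blockIndex_eq (hr0 : 0 < r) (hr1 : r < 1) {B : ℝ} {k : ℕ} (hB : 1 < B)
    (h1 : r ^ (2 * k + 2) * B ≤ 1) (h2 : 1 < r ^ (2 * k) * B) : blockIndex r B = k := by
  refine le_antisymm (blockIndex_le h1) ?_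
  by_contra! h
  have h3 := (blockIndex_spec hr0 hr1 hB).1
  have : r ^ (2 * k) ≤ r ^ (2 * blockIndex r B + 2) :=
    pow_le_pow_of_le_one hr0.le hr1.le (by omega)
  have := mul_le_mul_of_nonneg_right this (show 0 ≤ B by linarith)
  linarith

theorem one_lt_pow_mul (hr0 : 0 < r) (hr1 : r < 1) {B : ℝ} {j : ℕ} (hB : 1 < B)
    (hj : j ≤ blockIndex r B) : 1 < r ^ (2 * j) * B := by
  refine (blockIndex_spec hr0 hr1 hB).2.trans_le ?_
  have : r ^ (2 * blockIndex r B) ≤ r ^ (2 * j) := pow_le_pow_of_le_one hr0.le hr1.le (by omega)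
  exact mul_le_mul_of_nonneg_right this (by linarith)

/-- Keeps the even positions of a block on the forward branch; `thd s` may be negative, hence the
case split. -/
theorem pow_mul_thd_lt (hr0 : 0 < r) (hr1 : r < 1) {s : State} (hs : r * thd s < 1) (n : ℕ) :
    r * (r ^ n * thd s) < 1 := by
  have h1 : r ^ n ≤ 1 := pow_le_one₀ hr0.le hr1.le
  have h2 : 0 < r ^ n := pow_pos hr0 n
  rcases le_or_gt (thd s) 0 with h | h
  · have : r * (r ^ n * thd s) ≤ 0 :=
      mul_nonpos_of_nonneg_of_nonpos hr0.le (mul_nonpos_of_nonneg_of_nonpos h2.le h)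
    linarith
  · calc r * (r ^ n * thd s) = r ^ n * (r * thd s) := by ring
      _ ≤ 1 * (r * thd s) := mul_le_mul_of_nonneg_right h1 (by positivity)
      _ < 1 := by linarith

/-- A forward step makes the third coordinate `r B`; while `r ^ 2 B > 1` a backward step follows,
restoring the cone and scaling `A`, `B` by `r ^ 2`. -/
theorem step_iterate_even (hr0 : 0 < r) (hr1 : r < 1) {s : State} (hs : BlockStart r s) {j : ℕ}
    (hj : j ≤ blockIndex r s.2.2) :
    (step r)^[2 * j] s = (s.1, r ^ (2 * j) * s.2.1, r ^ (2 * j) * s.2.2) := by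
  induction j with
  | zero => simp
  | succ j ih =>
    have h1 := pow_mul_thd_lt hr0 hr1 hs.2 (2 * j)
    have h2 := one_lt_pow_mul hr0 hr1 hs.1.2 hj
    rw [show 2 * (j + 1) = 2 * j + 1 + 1 by ring, Function.iterate_succ_apply',
      Function.iterate_succ_apply', ih (by omega)]
    have e1 : thd (s.1, r ^ (2 * j) * s.2.1, r ^ (2 * j) * s.2.2) = r ^ (2 * j) * thd s := by
      simp only [thd]; ring
    rw [step_of_lt (s := (s.1, _, _)) (by rwa [e1]), e1]
    have e2 : r * thd (s.1 + 1, 1 - r * (r ^ (2 * j) * thd s), 1 + r * (r ^ (2 * j) * s.2.1))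
        = r ^ (2 * (j + 1)) * s.2.2 := by simp only [thd]; ring
    rw [step_of_gt (s := (s.1 + 1, _, _)) (by rwa [e2]), e2]
    refine Prod.ext ?_ (Prod.ext ?_ ?_)
    · simp only [add_assoc]
      rw [show (1 + 2 : Fin 3) = 0 from rfl, add_zero]
    · simp only; ring
    · simp only; ring

theorem step_iterate_odd (hr0 : 0 < r) (hr1 : r < 1) {s : State} (hs : BlockStart r s) {j : ℕ}
    (hj : j ≤ blockIndex r s.2.2) :
    (step r)^[2 * j + 1] s =
      (s.1 + 1, 1 - r ^ (2 * j + 1) * thd s, 1 + r ^ (2 * j + 1) * s.2.1) := by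
  have h1 := pow_mul_thd_lt hr0 hr1 hs.2 (2 * j)
  have e1 : thd (s.1, r ^ (2 * j) * s.2.1, r ^ (2 * j) * s.2.2) = r ^ (2 * j) * thd s := by
    simp only [thd]; ring
  rw [Function.iterate_succ_apply', step_iterate_even hr0 hr1 hs hj,
    step_of_lt (by rwa [e1]), e1, Prod.mk.injEq, Prod.mk.injEq]
  refine ⟨rfl, ?_, ?_⟩ <;> ring

theorem thd_block (s : State) :
    thd (block r s) = r ^ (2 * blockIndex r s.2.2 + 1) * s.2.2 := by
  simp only [thd, block]; ring

theorem block_eq_iterate (hr0 : 0 < r) (hr1 : r < 1) {s : State} (hs : BlockStart r s) :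
    block r s = (step r)^[2 * blockIndex r s.2.2 + 1] s :=
  (step_iterate_odd hr0 hr1 hs le_rfl).symm

/-- The block sequence of the state is defined and never meets the singular set. -/
def BlockRegular (r : ℝ) (s : State) : Prop :=
  BlockStart r s ∧ ∀ n, r * thd ((block r)^[n] s) < 1

theorem BlockStart.block (hr0 : 0 < r) (hr1 : r < 1) {s : State} (hs : BlockStart r s)
    (h : r * thd (block r s) < 1) : BlockStart r (block r s) := by
  refine ⟨⟨?_, ?_⟩, h⟩
  · have := pow_mul_thd_lt hr0 hr1 hs.2 (2 * blockIndex r s.2.2)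
    simp only [TriangleBilliard.block, sub_pos]
    calc _ = r * (r ^ (2 * blockIndex r s.2.2) * thd s) := by ring
      _ < 1 := this
  · have := mul_pos (pow_pos hr0 (2 * blockIndex r s.2.2 + 1)) hs.1.1
    simp only [TriangleBilliard.block]
    linarith

theorem BlockRegular.block (hr0 : 0 < r) (hr1 : r < 1) {s : State} (hs : BlockRegular r s) :
    BlockRegular r (block r s) :=
  ⟨hs.1.block hr0 hr1 (hs.2 1), fun n => hs.2 (n + 1)⟩

theorem BlockRegular.iterate (hr0 : 0 < r) (hr1 : r < 1) {s : State} (hs : BlockRegular r s)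
    (n : ℕ) : BlockRegular r ((TriangleBilliard.block r)^[n] s) := by
  induction n with
  | zero => exact hs
  | succ n ih => rw [Function.iterate_succ_apply']; exact ih.block hr0 hr1

theorem Regular.block (hr0 : 0 < r) (hr1 : r < 1) {s : State} (hs : Regular r s)
    (hb : BlockStart r s) : Regular r (block r s) ∧ BlockStart r (block r s) := by
  have h := hs.iterate hr0 (2 * blockIndex r s.2.2 + 1)
  rw [← block_eq_iterate hr0 hr1 hb] at h
  -- The choice of the index only gives `≤`; equality would be singular.
  refine ⟨h, h.1, lt_of_le_of_ne ?_ (h.2 0)⟩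
  rw [thd_block]
  calc _ = r ^ (2 * blockIndex r s.2.2 + 2) * s.2.2 := by ring
    _ ≤ 1 := (blockIndex_spec hr0 hr1 hb.1.2).1

theorem Regular.blockRegular (hr0 : 0 < r) (hr1 : r < 1) {s : State} (hs : Regular r s)
    (hb : BlockStart r s) : BlockRegular r s := by
  have key : ∀ n, Regular r ((TriangleBilliard.block r)^[n] s) ∧
      BlockStart r ((TriangleBilliard.block r)^[n] s) := by
    intro n
    induction n with
    | zero => exact ⟨hs, hb⟩
    | succ n ih => rw [Function.iterate_succ_apply']; exact ih.1.block hr0 hr1 ih.2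
  exact ⟨hb, fun n => (key n).2.2⟩

/-- A backward step leaves the third coordinate `r (1 - A) < r`, so at most one step precedes the
first block. -/
theorem Regular.exists_blockRegular (hr0 : 0 < r) (hr1 : r < 1) {s : State} (hs : Regular r s) :
    ∃ n, BlockRegular r ((TriangleBilliard.step r)^[n] s) := by
  rcases lt_or_gt_of_ne (show r * thd s ≠ 1 from hs.2 0) with h | h
  · exact ⟨0, hs.blockRegular hr0 hr1 ⟨hs.1, h⟩⟩
  · have h' := hs.step hr0
    refine ⟨1, h'.blockRegular hr0 hr1 ⟨h'.1, ?_⟩⟩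
    have e : thd (TriangleBilliard.step r s) = r * (1 - s.2.1) := by
      rw [step_of_gt h]; simp only [thd]; ring
    rw [e]
    have := mul_pos (mul_pos hr0 hr0) hs.1.1
    nlinarith

/-- Within a block, the third coordinate stays outside `[r, 1 / r]`. -/
theorem thd_within_block (hr0 : 0 < r) (hr1 : r < 1) {s : State} (hs : BlockStart r s) {n : ℕ}
    (hn0 : 0 < n) (hn : n < 2 * blockIndex r s.2.2 + 1) :
    thd ((step r)^[n] s) < r ∨ 1 < r * thd ((step r)^[n] s) := by
  rcases Nat.even_or_odd' n with ⟨j, rfl | rfl⟩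
  · left
    have hj : j - 1 + 1 = j := by omega
    rw [step_iterate_even hr0 hr1 hs (by omega)]
    have h1 := pow_mul_thd_lt hr0 hr1 hs.2 (2 * (j - 1))
    have : thd (s.1, r ^ (2 * j) * s.2.1, r ^ (2 * j) * s.2.2)
        = r * (r * (r ^ (2 * (j - 1)) * thd s)) := by
      rw [← hj]; simp only [thd, Nat.add_sub_cancel]; ring
    rw [this]
    exact mul_lt_of_lt_one_right hr0 h1
  · right
    rw [step_iterate_odd hr0 hr1 hs (by omega)]
    have := one_lt_pow_mul hr0 hr1 hs.1.2 (show j + 1 ≤ blockIndex r s.2.2 by omega)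
    refine this.trans_eq ?_
    simp only [thd]; ring

/-- Times inside a block are handled by `thd_within_block`; later times by removing the first block.
-/
theorem BlockRegular.thd_step_ne (hr0 : 0 < r) (hr1 : r < 1) (n : ℕ) :
    ∀ s, BlockRegular r s → r * thd ((step r)^[n] s) ≠ 1 := by
  induction n using Nat.strong_induction_on with
  | _ n ih =>
    intro s hs
    rcases Nat.eq_zero_or_pos n with rfl | hn0
    · exact (hs.2 0).ne
    rcases lt_or_ge n (2 * blockIndex r s.2.2 + 1) with h | h
    · rcases thd_within_block hr0 hr1 hs.1 hn0 h with h | h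
      · nlinarith
      · exact h.ne'
    · obtain ⟨m, rfl⟩ := Nat.exists_eq_add_of_le' h
      rw [Function.iterate_add_apply, ← block_eq_iterate hr0 hr1 hs.1]
      exact ih m (by omega) _ (hs.block hr0 hr1)

theorem BlockRegular.regular (hr0 : 0 < r) (hr1 : r < 1) {s : State} (hs : BlockRegular r s) :
    Regular r s :=
  ⟨hs.1.1, fun n => BlockRegular.thd_step_ne hr0 hr1 n s hs⟩

theorem step_iterate_fst_congr (hr0 : 0 < r) (hr1 : r < 1) (n : ℕ) :
    ∀ s t, BlockRegular r s → BlockRegular r t → s.1 = t.1 →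
      (∀ m, blockIndex r ((block r)^[m] s).2.2 = blockIndex r ((block r)^[m] t).2.2) →
      ((step r)^[n] s).1 = ((step r)^[n] t).1 := by
  induction n using Nat.strong_induction_on with
  | _ n ih =>
    intro s t hs ht hst hk
    have hk0 : blockIndex r s.2.2 = blockIndex r t.2.2 := hk 0
    rcases lt_or_ge n (2 * blockIndex r s.2.2 + 1) with h | h
    · rcases Nat.even_or_odd' n with ⟨j, rfl | rfl⟩
      · rw [step_iterate_even hr0 hr1 hs.1 (by omega), step_iterate_even hr0 hr1 ht.1 (by omega)]
        exact hst
      · rw [step_iterate_odd hr0 hr1 hs.1 (by omega), step_iterate_odd hr0 hr1 ht.1 (by omega)]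
        simp only [hst]
    · obtain ⟨m, rfl⟩ := Nat.exists_eq_add_of_le' h
      rw [Function.iterate_add_apply _ m, Function.iterate_add_apply _ m,
        ← block_eq_iterate hr0 hr1 hs.1, hk0, ← block_eq_iterate hr0 hr1 ht.1]
      exact ih m (by omega) _ _ (hs.block hr0 hr1) (ht.block hr0 hr1)
        (by simp only [TriangleBilliard.block, hst]) fun m => hk (m + 1)

/-- The number of steps in the first `t` blocks. -/
def blockTime (r : ℝ) (s : State) (t : ℕ) : ℕ :=
  ∑ j ∈ Finset.range t, (2 * blockIndex r ((block r)^[j] s).2.2 + 1)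

theorem BlockRegular.iterate_blockTime (hr0 : 0 < r) (hr1 : r < 1) {s : State}
    (hs : BlockRegular r s) (t : ℕ) :
    (step r)^[blockTime r s t] s = (TriangleBilliard.block r)^[t] s := by
  induction t with
  | zero => simp [blockTime]
  | succ t ih =>
    rw [blockTime, Finset.sum_range_succ, add_comm, Function.iterate_add_apply, ← blockTime, ih,
      ← block_eq_iterate hr0 hr1 (hs.iterate hr0 hr1 t).1, Function.iterate_succ_apply']

/-- Block boundaries are visible in the orbit, since inside a block the third coordinate avoids `(r,
1 / r)`. This excludes periodic returns in the middle of a block. -/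
theorem BlockRegular.exists_blockTime (hr0 : 0 < r) (hr1 : r < 1) (n : ℕ) :
    ∀ s, BlockRegular r s → r < thd ((step r)^[n] s) → r * thd ((step r)^[n] s) < 1 →
      ∃ t, n = blockTime r s t := by
  induction n using Nat.strong_induction_on with
  | _ n ih =>
    intro s hs h1 h2
    rcases Nat.eq_zero_or_pos n with rfl | hn0
    · exact ⟨0, rfl⟩
    rcases lt_or_ge n (2 * blockIndex r s.2.2 + 1) with h | h
    · rcases thd_within_block hr0 hr1 hs.1 hn0 h with h | h <;> linarith
    · obtain ⟨m, rfl⟩ := Nat.exists_eq_add_of_le' h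
      rw [Function.iterate_add_apply, ← block_eq_iterate hr0 hr1 hs.1] at h1 h2
      obtain ⟨t, rfl⟩ := ih m (by omega) _ (hs.block hr0 hr1) h1 h2
      refine ⟨t + 1, ?_⟩
      simp only [blockTime, Finset.sum_range_succ', Function.iterate_succ_apply,
        Function.iterate_zero_apply]

theorem block_iterate_fst (s : State) (t : ℕ) :
    (((block r)^[t] s).1 : ℕ) = (s.1 + t) % 3 := by
  induction t with
  | zero => simp [Nat.mod_eq_of_lt s.1.isLt]
  | succ t ih =>
    rw [Function.iterate_succ_apply']
    simp only [block, Fin.val_add, ih]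
    simp
    omega

/-! ### Block sequences are eventually periodic -/

theorem lt_thd_block (hr0 : 0 < r) (hr1 : r < 1) {s : State} (hs : Pos s) :
    r < thd (block r s) := by
  have := mul_lt_mul_of_pos_left (blockIndex_spec hr0 hr1 hs.2).2 hr0
  rw [thd_block]
  calc r = r * 1 := by ring
    _ < _ := this
    _ = _ := by ring

/-- Put `y = r ρ`. From `A < B - r` and `r ρ B ≤ 1`, the quantity to bound is at most `r ^ 2 y (1 -
y) + r y ≤ (1 - y) + y = 1`. -/
theorem blockIndex_block_le (hr0 : 0 < r) (hr1 : r < 1) {s : State} (hs : Pos s)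
    (hC : r < thd s) : blockIndex r (block r s).2.2 ≤ blockIndex r s.2.2 + 1 := by
  apply blockIndex_le
  have hB := (blockIndex_spec hr0 hr1 hs.2).1
  have hρ : 0 < r ^ (2 * blockIndex r s.2.2 + 1) := by positivity
  have hρ1 : r ^ (2 * blockIndex r s.2.2 + 1) ≤ 1 := pow_le_one₀ hr0.le hr1.le
  simp only [block]
  rw [show r ^ (2 * (blockIndex r s.2.2 + 1) + 2) = r ^ 3 * r ^ (2 * blockIndex r s.2.2 + 1) by ring]
  rw [show r ^ (2 * blockIndex r s.2.2 + 2) = r * r ^ (2 * blockIndex r s.2.2 + 1) by ring] at hB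
  generalize r ^ (2 * blockIndex r s.2.2 + 1) = ρ at *
  have hA : s.2.1 < s.2.2 - r := by simp only [thd] at hC; linarith
  have hy0 : 0 < r * ρ := by positivity
  have hy1 : r * ρ < 1 := by nlinarith
  have h1 : r ^ 3 * ρ * (1 + ρ * s.2.1) ≤ r ^ 3 * ρ * (1 + ρ * (s.2.2 - r)) := by gcongr
  have h2 : r ^ 3 * ρ * (1 + ρ * (s.2.2 - r)) ≤ r ^ 2 * (r * ρ) + r * (r * ρ) - r ^ 2 * (r * ρ) ^ 2 := by
    have := mul_le_mul_of_nonneg_left hB (show 0 ≤ r ^ 2 * ρ by positivity)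
    linarith
  have h3 : r ^ 2 * (r * ρ) * (1 - r * ρ) ≤ 1 * (1 - r * ρ) := by
    apply mul_le_mul_of_nonneg_right _ (by linarith)
    have : r ^ 2 ≤ 1 := pow_le_one₀ hr0.le hr1.le
    nlinarith
  have h4 : r * (r * ρ) ≤ r * ρ := mul_le_of_le_one_left hy0.le hr1.le
  linarith

/-- With `y = r ρ`, the bound `r < C` reduces the claim to `y + y σ (1 - y) ≤ 1`, that is, `(1 - y)
(1 - y σ) ≥ 0`. About the middle block only `0 < σ ≤ 1` matters. -/
theorem blockIndex_block_block_le (hr0 : 0 < r) (hr1 : r < 1) {s : State} (hC : r < thd s) :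
    blockIndex r (block r (block r s)).2.2 ≤ blockIndex r s.2.2 := by
  apply blockIndex_le
  set k' := blockIndex r (block r s).2.2 with hk'
  have hρ : 0 < r ^ (2 * blockIndex r s.2.2 + 1) := by positivity
  have hρ1 : r ^ (2 * blockIndex r s.2.2 + 1) ≤ 1 := pow_le_one₀ hr0.le hr1.le
  have hσ : 0 < r ^ (2 * k' + 1) := by positivity
  have hσ1 : r ^ (2 * k' + 1) ≤ 1 := pow_le_one₀ hr0.le hr1.le
  have e : (block r (block r s)).2.2
      = 1 + r ^ (2 * k' + 1) * (1 - r ^ (2 * blockIndex r s.2.2 + 1) * thd s) := rfl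
  rw [e, show r ^ (2 * blockIndex r s.2.2 + 2) = r * r ^ (2 * blockIndex r s.2.2 + 1) by ring]
  generalize r ^ (2 * k' + 1) = σ at *
  generalize r ^ (2 * blockIndex r s.2.2 + 1) = ρ at *
  have h1 : r * ρ * (1 + σ * (1 - ρ * thd s)) ≤ r * ρ * (1 + σ * (1 - ρ * r)) := by gcongr
  have hy1 : r * ρ ≤ 1 := by nlinarith
  have hyσ : r * ρ * σ ≤ 1 := mul_le_one₀ hy1 hσ.le hσ1
  nlinarith [mul_nonneg (sub_nonneg.2 hy1) (sub_nonneg.2 hyσ)]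

/-- The sums `f n + f (n + 1)` are nonincreasing naturals; once they are minimal they stay constant.
-/
theorem eventually_two_periodic {f : ℕ → ℕ} (h : ∀ n, f (n + 2) ≤ f n) :
    ∃ N, ∀ n, N ≤ n → f (n + 2) = f n := by
  obtain ⟨N, hN⟩ := Nat.sInf_mem (Set.range_nonempty fun n => f n + f (n + 1))
  have hmin : ∀ m, f N + f (N + 1) ≤ f m + f (m + 1) := fun m => by
    rw [show f N + f (N + 1) = _ from hN]; exact Nat.sInf_le ⟨m, rfl⟩
  have key : ∀ n, f (N + n) + f (N + n + 1) ≤ f N + f (N + 1) := by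
    intro n
    induction n with
    | zero => rfl
    | succ n ih =>
      have := h (N + n)
      rw [← add_assoc, show N + n + 1 + 1 = N + n + 2 from rfl]
      omega
  refine ⟨N, fun n hn => ?_⟩
  obtain ⟨m, rfl⟩ := Nat.exists_eq_add_of_le hn
  have h1 := key m
  have h2 := hmin (N + m + 1)
  have h3 := h (N + m)
  rw [show N + m + 1 + 1 = N + m + 2 from rfl] at h2
  omega

/-- The blocks of `s` have alternately the indices `k` and `k'`. -/
def Alternates (r : ℝ) (k k' : ℕ) (s : State) : Prop :=
  ∀ n, blockIndex r ((block r)^[2 * n] s).2.2 = k ∧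
    blockIndex r ((block r)^[2 * n + 1] s).2.2 = k'

theorem BlockRegular.exists_alternates (hr0 : 0 < r) (hr1 : r < 1) {s : State}
    (hs : BlockRegular r s) : ∃ N k k', (k' = k ∨ k' = k + 1) ∧
      r < thd ((TriangleBilliard.block r)^[N] s) ∧
      Alternates r k k' ((TriangleBilliard.block r)^[N] s) := by
  set b := TriangleBilliard.block r with hb
  have hC : ∀ n, r < thd (b^[n + 1] s) := fun n => by
    rw [Function.iterate_succ_apply']; exact lt_thd_block hr0 hr1 (hs.iterate hr0 hr1 n).1.1
  set f : ℕ → ℕ := fun n => blockIndex r (b^[n + 1] s).2.2 with hf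
  have h1 : ∀ n, f (n + 1) ≤ f n + 1 := fun n => by
    simp only [hf]
    rw [Function.iterate_succ_apply' b (n + 1)]
    exact blockIndex_block_le hr0 hr1 (hs.iterate hr0 hr1 (n + 1)).1.1 (hC n)
  have h2 : ∀ n, f (n + 2) ≤ f n := fun n => by
    simp only [hf]
    rw [Function.iterate_succ_apply' b (n + 2), Function.iterate_succ_apply' b (n + 1)]
    exact blockIndex_block_block_le hr0 hr1 (hC n)
  obtain ⟨N, hN⟩ := eventually_two_periodic h2
  have hper : ∀ M, N ≤ M → ∀ n, f (M + 2 * n) = f M := by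
    intro M hM n
    induction n with
    | zero => rfl
    | succ n ih => rw [← ih]; exact hN (M + 2 * n) (by omega)
  have halt : ∀ M, N ≤ M → Alternates r (f M) (f (M + 1)) (b^[M + 1] s) := by
    intro M hM n
    rw [← hper M hM n, ← hper (M + 1) (by omega) n, ← hb, ← Function.iterate_add_apply,
      ← Function.iterate_add_apply, show 2 * n + (M + 1) = M + 2 * n + 1 by ring,
      show 2 * n + 1 + (M + 1) = M + 1 + 2 * n + 1 by ring]
    exact ⟨rfl, rfl⟩
  have e1 := h1 N
  have e2 := h1 (N + 1)
  have e3 := hN N le_rfl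
  rw [show N + 1 + 1 = N + 2 from rfl, e3] at e2
  -- Start at the smaller of the two values, so that `k'` is `k` or `k + 1`.
  by_cases h : f N ≤ f (N + 1)
  · exact ⟨N + 1, f N, f (N + 1), by omega, hC N, halt N le_rfl⟩
  · have := halt (N + 1) (by omega)
    rw [show N + 1 + 1 = N + 2 from rfl, e3] at this
    exact ⟨N + 2, f (N + 1), f N, by omega, hC (N + 1), this⟩

/-- A weighted sum of the third coordinates of `s` and of its second and fourth iterates under the
block map is the constant `σ (1 + ρ + ρ σ)`; all three coordinates exceed `r`. -/
theorem Alternates.lt (hr0 : 0 < r) (hr1 : r < 1) {s : State} {k k' : ℕ} (hs : BlockRegular r s)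
    (hC : r < thd s) (h : Alternates r k k' s) {ρ σ : ℝ} (hρ : ρ = r ^ (2 * k + 1))
    (hσ : σ = r ^ (2 * k' + 1)) :
    r * (1 + ρ * σ + ρ ^ 2 * σ ^ 2) < σ * (1 + ρ + ρ * σ) := by
  have hC2 := lt_thd_block hr0 hr1 (hs.iterate hr0 hr1 1).1.1
  have hC4 := lt_thd_block hr0 hr1 (hs.iterate hr0 hr1 3).1.1
  have k0 : blockIndex r s.2.2 = k := (h 0).1
  have k1 : blockIndex r (block r s).2.2 = k' := (h 0).2
  have k2 : blockIndex r (block r (block r s)).2.2 = k := (h 1).1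
  have k3 : blockIndex r (block r (block r (block r s))).2.2 = k' := (h 1).2
  have hb : ∀ t, block r t = (t.1 + 1, 1 - r ^ (2 * blockIndex r t.2.2 + 1) * thd t,
    1 + r ^ (2 * blockIndex r t.2.2 + 1) * t.2.1) := fun t => rfl
  have b1 := hb s
  have b2 := hb (block r s)
  have b3 := hb (block r (block r s))
  rw [k0, ← hρ] at b1
  rw [k1, ← hσ] at b2
  rw [k2, ← hρ] at b3
  simp only [Function.iterate_succ_apply, Function.iterate_zero_apply] at hC2 hC4
  rw [thd_block, k1, ← hσ] at hC2
  rw [thd_block, k3, ← hσ] at hC4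
  have B1 : (block r s).2.2 = 1 + ρ * s.2.1 := by rw [b1]
  have A1 : (block r s).2.1 = 1 - ρ * thd s := by rw [b1]
  have T1 : thd (block r s) = ρ * s.2.2 := by rw [thd_block, k0, hρ]
  have T2 : thd (block r (block r s)) = σ * (block r s).2.2 := by rw [thd_block, k1, hσ]
  have A2 : (block r (block r s)).2.1 = 1 - σ * thd (block r s) := by rw [b2]
  have B3 : (block r (block r (block r s))).2.2 = 1 + ρ * (block r (block r s)).2.1 := by rw [b3]
  rw [B3, A2, T1] at hC4
  rw [B1] at hC2
  have hρ0 : 0 < ρ := by rw [hρ]; positivity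
  have hσ0 : 0 < σ := by rw [hσ]; positivity
  -- The weights `1`, `ρ σ`, `ρ ^ 2 σ ^ 2` on the fourth, second and zeroth third coordinates cancel
  -- `A` and `B` of `s`.
  have m2 := mul_lt_mul_of_pos_left hC2 (mul_pos hρ0 hσ0)
  have m0 := mul_lt_mul_of_pos_left hC (show 0 < ρ ^ 2 * σ ^ 2 by positivity)
  simp only [thd] at m0
  linarith

/-! ### Periodic states -/

/-- The state with cone index `i` whose blocks alternate between `k` and `k'` forever. -/
def periodicState (r : ℝ) (k k' : ℕ) (i : Fin 3) : State :=
  (i, (1 - r ^ (2 * k + 1) * (r ^ (2 * k' + 1)) ^ 2) /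
      (1 + r ^ (2 * k + 1) * r ^ (2 * k' + 1) + (r ^ (2 * k + 1)) ^ 2 * (r ^ (2 * k' + 1)) ^ 2),
    (1 + r ^ (2 * k' + 1) + r ^ (2 * k + 1) * r ^ (2 * k' + 1)) /
      (1 + r ^ (2 * k + 1) * r ^ (2 * k' + 1) + (r ^ (2 * k + 1)) ^ 2 * (r ^ (2 * k' + 1)) ^ 2))

/-- The condition for the state alternating between `k` and `k'` to be non-singular. -/
def Balanced (r : ℝ) (k k' : ℕ) : Prop :=
  ∀ ρ σ : ℝ, (ρ = r ^ (2 * k + 1) ∧ σ = r ^ (2 * k' + 1)) ∨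
      (ρ = r ^ (2 * k' + 1) ∧ σ = r ^ (2 * k + 1)) →
    r * (1 + ρ * σ + ρ ^ 2 * σ ^ 2) < ρ * (1 + σ + ρ * σ) ∧
      r * (ρ * (1 + σ + ρ * σ)) < 1 + ρ * σ + ρ ^ 2 * σ ^ 2

theorem Balanced.symm {k k' : ℕ} (h : Balanced r k k') : Balanced r k' k :=
  fun ρ σ hρσ => h ρ σ hρσ.symm

/-- `Balanced` places `ρ B` and `C` in `(r, 1 / r)`: the former determines the index `k`, the latter
allows a block to start. -/
theorem blockIndex_periodicState (hr0 : 0 < r) (hr1 : r < 1) {k k' : ℕ} (h : Balanced r k k')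
    (i : Fin 3) : BlockStart r (periodicState r k k' i) ∧
      blockIndex r (periodicState r k k' i).2.2 = k := by
  obtain ⟨h1, h2⟩ := h _ _ (Or.inl ⟨rfl, rfl⟩)
  obtain ⟨h3, h4⟩ := h _ _ (Or.inr ⟨rfl, rfl⟩)
  have hρ : 0 < r ^ (2 * k + 1) := by positivity
  have hσ : 0 < r ^ (2 * k' + 1) := by positivity
  have hρ1 : r ^ (2 * k + 1) ≤ r := pow_le_of_le_one hr0.le hr1.le (by omega)
  have hσ1 : r ^ (2 * k' + 1) ≤ r := pow_le_of_le_one hr0.le hr1.le (by omega)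
  have e1 : r ^ (2 * k + 2) = r * r ^ (2 * k + 1) := by ring
  have e2 : r * r ^ (2 * k) = r ^ (2 * k + 1) := by ring
  simp only [BlockStart, Pos, thd, periodicState]
  set ρ := r ^ (2 * k + 1)
  set σ := r ^ (2 * k' + 1)
  set D := 1 + ρ * σ + ρ ^ 2 * σ ^ 2 with hD
  have hD0 : 0 < D := by positivity
  have hB : 1 < (1 + σ + ρ * σ) / D := by
    rw [lt_div_iff₀ hD0]
    have h5 : ρ * (1 + σ + ρ * σ) ≤ r * (1 + σ + ρ * σ) := by gcongr
    have := lt_of_mul_lt_mul_left (h1.trans_le h5) hr0.le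
    linarith
  have hρσ : ρ * σ ^ 2 < 1 := by nlinarith [mul_pos hσ hσ]
  refine ⟨⟨⟨div_pos (by linarith) hD0, hB⟩, ?_⟩, blockIndex_eq hr0 hr1 hB ?_ ?_⟩
  · rw [← sub_div, ← mul_div_assoc, div_lt_one hD0]
    linarith
  · rw [e1, ← mul_div_assoc, div_le_one hD0]
    linarith
  · rw [← mul_div_assoc, lt_div_iff₀ hD0]
    apply lt_of_mul_lt_mul_left _ hr0.le
    rw [← mul_assoc r (r ^ (2 * k)), e2]
    linarith

/-- The coordinates of `periodicState` solve the linear equations of the alternating recurrence, so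
a block just exchanges `k` and `k'`. -/
theorem block_periodicState (hr0 : 0 < r) (hr1 : r < 1) {k k' : ℕ} (h : Balanced r k k')
    (i : Fin 3) : block r (periodicState r k k' i) = periodicState r k' k (i + 1) := by
  have hk := (blockIndex_periodicState hr0 hr1 h i).2
  rw [block, hk]
  simp only [thd, periodicState]
  have hρ : 0 < r ^ (2 * k + 1) := by positivity
  have hσ : 0 < r ^ (2 * k' + 1) := by positivity
  generalize r ^ (2 * k + 1) = ρ at *
  generalize r ^ (2 * k' + 1) = σ at *
  have h1 : 1 + ρ * σ + ρ ^ 2 * σ ^ 2 ≠ 0 := by positivity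
  have h2 : 1 + σ * ρ + σ ^ 2 * ρ ^ 2 ≠ 0 := by positivity
  rw [Prod.mk.injEq, Prod.mk.injEq]
  refine ⟨rfl, ?_, ?_⟩
  · field_simp; ring
  · field_simp; ring

theorem block_iterate_periodicState (hr0 : 0 < r) (hr1 : r < 1) {k k' : ℕ} (h : Balanced r k k')
    (i : Fin 3) (n : ℕ) : ∃ j : Fin 3,
      (block r)^[2 * n] (periodicState r k k' i) = periodicState r k k' j ∧
      (block r)^[2 * n + 1] (periodicState r k k' i) = periodicState r k' k (j + 1) := by
  have key : ∃ j : Fin 3, (block r)^[2 * n] (periodicState r k k' i) = periodicState r k k' j := by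
    induction n with
    | zero => exact ⟨i, rfl⟩
    | succ n ih =>
      obtain ⟨j, hj⟩ := ih
      refine ⟨j + 1 + 1, ?_⟩
      rw [show 2 * (n + 1) = 2 * n + 1 + 1 by ring, Function.iterate_succ_apply',
        Function.iterate_succ_apply', hj, block_periodicState hr0 hr1 h,
        block_periodicState hr0 hr1 h.symm]
  obtain ⟨j, hj⟩ := key
  exact ⟨j, hj, by rw [Function.iterate_succ_apply', hj, block_periodicState hr0 hr1 h]⟩

theorem alternates_periodicState (hr0 : 0 < r) (hr1 : r < 1) {k k' : ℕ} (h : Balanced r k k')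
    (i : Fin 3) : Alternates r k k' (periodicState r k k' i) := by
  intro n
  obtain ⟨j, h1, h2⟩ := block_iterate_periodicState hr0 hr1 h i n
  rw [h1, h2]
  exact ⟨(blockIndex_periodicState hr0 hr1 h _).2, (blockIndex_periodicState hr0 hr1 h.symm _).2⟩

theorem blockRegular_periodicState (hr0 : 0 < r) (hr1 : r < 1) {k k' : ℕ} (h : Balanced r k k')
    (i : Fin 3) : BlockRegular r (periodicState r k k' i) := by
  refine ⟨(blockIndex_periodicState hr0 hr1 h _).1, fun n => ?_⟩
  rcases Nat.even_or_odd' n with ⟨m, rfl | rfl⟩ <;>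
    obtain ⟨j, h1, h2⟩ := block_iterate_periodicState hr0 hr1 h i m
  · rw [h1]; exact (blockIndex_periodicState hr0 hr1 h _).1.2
  · rw [h2]; exact (blockIndex_periodicState hr0 hr1 h.symm _).1.2

theorem lt_thd_periodicState (hr0 : 0 < r) (hr1 : r < 1) {k k' : ℕ} (h : Balanced r k k')
    (i : Fin 3) : r < thd (periodicState r k k' i) := by
  have := block_periodicState hr0 hr1 h.symm (i + 2)
  rw [add_assoc, show (2 + 1 : Fin 3) = 0 from rfl, add_zero] at this
  rw [← this]
  exact lt_thd_block hr0 hr1 (blockIndex_periodicState hr0 hr1 h.symm _).1.1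

/-- Every index occurs along the orbit of a periodic state. -/
theorem exists_step_iterate_periodicState (hr0 : 0 < r) (hr1 : r < 1) {k k' : ℕ}
    (h : Balanced r k k') (i : Fin 3) :
    ∃ n, (step r)^[n] (periodicState r k k' 0) = periodicState r k k' i := by
  have hb := blockRegular_periodicState hr0 hr1 h 0
  have key : ∀ n : ℕ, ∃ j : Fin 3, (j : ℕ) = (2 * n) % 3 ∧
      (block r)^[2 * n] (periodicState r k k' 0) = periodicState r k k' j := fun n => by
    obtain ⟨j, hj, -⟩ := block_iterate_periodicState hr0 hr1 h 0 n
    refine ⟨j, ?_, hj⟩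
    have := block_iterate_fst (r := r) (periodicState r k k' 0) (2 * n)
    rw [hj] at this
    simpa [periodicState] using this
  -- After `4 i` blocks the cone index is `4 i ≡ i` modulo 3, and an even number of blocks keeps
  -- `k`, `k'` in order.
  obtain ⟨j, hj, e⟩ := key (2 * i)
  have : j = i := Fin.ext (by omega)
  subst this
  exact ⟨_, (hb.iterate_blockTime hr0 hr1 _).trans e⟩

theorem blockTime_mono (s : State) : Monotone (blockTime r s) := by
  intro a b hab
  exact Finset.sum_le_sum_of_subset (Finset.range_subset_range.2 hab)

theorem minimalPeriod_periodicState (hr0 : 0 < r) (hr1 : r < 1) {k k' t : ℕ}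
    (h : Balanced r k k') (ht0 : 0 < t)
    (ht : (block r)^[t] (periodicState r k k' 0) = periodicState r k k' 0)
    (hmin : ∀ m, 0 < m → (block r)^[m] (periodicState r k k' 0) = periodicState r k k' 0 → t ≤ m) :
    Function.minimalPeriod (step r) (periodicState r k k' 0) =
      blockTime r (periodicState r k k' 0) t := by
  have hb := blockRegular_periodicState hr0 hr1 h 0
  have hper : Function.IsPeriodicPt (step r) (blockTime r (periodicState r k k' 0) t)
      (periodicState r k k' 0) := (hb.iterate_blockTime hr0 hr1 t).trans ht
  have hpos : 0 < blockTime r (periodicState r k k' 0) t := by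
    refine lt_of_lt_of_le ?_ (blockTime_mono _ (show 1 ≤ t from ht0))
    simp [blockTime]
  refine le_antisymm (hper.minimalPeriod_le hpos) ?_
  have hm : (step r)^[Function.minimalPeriod (step r) (periodicState r k k' 0)]
      (periodicState r k k' 0) = periodicState r k k' 0 := Function.iterate_minimalPeriod
  have hm0 := hper.minimalPeriod_pos hpos
  obtain ⟨m, e⟩ := BlockRegular.exists_blockTime hr0 hr1 _ _ hb
    (by rw [hm]; exact lt_thd_periodicState hr0 hr1 h 0) (by rw [hm]; exact hb.1.2)
  rw [e, hb.iterate_blockTime hr0 hr1] at hm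
  rw [e] at hm0 ⊢
  refine blockTime_mono _ (hmin m ?_ hm)
  rcases Nat.eq_zero_or_pos m with rfl | hpos
  · simp [blockTime] at hm0
  · exact hpos

theorem three_dvd_of_block_iterate_eq {s : State} {m : ℕ} (h : (block r)^[m] s = s) : 3 ∣ m := by
  have := block_iterate_fst (r := r) s m
  rw [h] at this
  omega

theorem minimalPeriod_periodicState_self (hr0 : 0 < r) (hr1 : r < 1) {k : ℕ}
    (h : Balanced r k k) :
    Function.minimalPeriod (step r) (periodicState r k k 0) = 3 * (2 * k + 1) := by
  rw [minimalPeriod_periodicState hr0 hr1 h (t := 3) (by norm_num)]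
  · have h0 := alternates_periodicState hr0 hr1 h 0
    simp only [blockTime, Finset.sum_range_succ, Finset.sum_range_zero]
    rw [(h0 0).1, (h0 0).2, (h0 1).1]
    ring
  · simp only [Function.iterate_succ_apply, Function.iterate_zero_apply,
      block_periodicState hr0 hr1 h]
    rfl
  · intro m hm hper
    have := three_dvd_of_block_iterate_eq hper
    omega

/-- The number of blocks in a return is divisible by 3 because of the cone index, and even because
`k ≠ k'`. -/
theorem minimalPeriod_periodicState_of_ne (hr0 : 0 < r) (hr1 : r < 1) {k k' : ℕ}
    (h : Balanced r k k') (hne : k ≠ k') :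
    Function.minimalPeriod (step r) (periodicState r k k' 0) = 6 * (k + k' + 1) := by
  have h0 := alternates_periodicState hr0 hr1 h 0
  rw [minimalPeriod_periodicState hr0 hr1 h (t := 6) (by norm_num)]
  · simp only [blockTime, Finset.sum_range_succ, Finset.sum_range_zero]
    rw [(h0 0).1, (h0 0).2, (h0 1).1, (h0 1).2, (h0 2).1, (h0 2).2]
    ring
  · simp only [Function.iterate_succ_apply, Function.iterate_zero_apply,
      block_periodicState hr0 hr1 h, block_periodicState hr0 hr1 h.symm]
    rfl
  · intro m hm hper
    have h3 := three_dvd_of_block_iterate_eq hper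
    rcases Nat.even_or_odd' m with ⟨n, rfl | rfl⟩
    · omega
    · have := (h0 n).2
      rw [hper, (blockIndex_periodicState hr0 hr1 h 0).2] at this
      exact absurd this hne

/-! ### Periodic orbits and convergence -/

/-- The periodic orbit whose blocks alternate between `k` and `k'`. -/
def periodicOrbit (r : ℝ) (k k' : ℕ) : Set ℂ :=
  Set.range fun n : ℕ => (T r)^[n] (point r (periodicState r k k' 0))

theorem Regular.minimalPeriod_T (hr0 : 0 < r) (hr1 : r < 1) {s : State} (hs : Regular r s) :
    Function.minimalPeriod (T r) (point r s) = Function.minimalPeriod (TriangleBilliard.step r) s := by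
  rw [Function.minimalPeriod_eq_minimalPeriod_iff]
  intro n
  rw [Function.IsPeriodicPt, Function.IsFixedPt, hs.iterate_T hr0 hr1]
  exact ⟨point_injective hr1 (hs.iterate hr0 n).1 hs.1, fun h => congrArg _ h⟩

theorem isPeriodicOrbit_self (hr0 : 0 < r) (hr1 : r < 1) {k : ℕ} (h : Balanced r k k) :
    IsPeriodicOrbit r (3 * (2 * k + 1)) (periodicOrbit r k k) := by
  have hs := (blockRegular_periodicState hr0 hr1 h 0).regular hr0 hr1
  exact ⟨_, hs.nonSingular hr0 hr1, by omega,
    by rw [hs.minimalPeriod_T hr0 hr1, minimalPeriod_periodicState_self hr0 hr1 h], rfl⟩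

theorem isPeriodicOrbit_of_ne (hr0 : 0 < r) (hr1 : r < 1) {k k' : ℕ} (h : Balanced r k k')
    (hne : k ≠ k') : IsPeriodicOrbit r (6 * (k + k' + 1)) (periodicOrbit r k k') := by
  have hs := (blockRegular_periodicState hr0 hr1 h 0).regular hr0 hr1
  exact ⟨_, hs.nonSingular hr0 hr1, by omega,
    by rw [hs.minimalPeriod_T hr0 hr1, minimalPeriod_periodicState_of_ne hr0 hr1 h hne], rfl⟩

theorem IsPeriodicOrbit.period_eq {p q : ℕ} {Γ : Set ℂ} (hp : IsPeriodicOrbit r p Γ)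
    (hq : IsPeriodicOrbit r q Γ) : p = q := by
  obtain ⟨z, -, hp0, hz, rfl⟩ := hp
  obtain ⟨w, -, hq0, hw, e⟩ := hq
  obtain ⟨n, hn⟩ : w ∈ Set.range fun n : ℕ => (T r)^[n] z := e ▸ ⟨0, rfl⟩
  have hzp : z ∈ Function.periodicPts (T r) :=
    Function.minimalPeriod_pos_iff_mem_periodicPts.1 (hz ▸ hp0)
  rw [← hz, ← hw, ← hn]
  exact (Function.minimalPeriod_apply_iterate hzp n).symm

/-! ### Thresholds -/

/-- Dividing by `x - 1` removes the root at `1`. The cofactor `h` then has a single root on `[0,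
1]`, and the intermediate value theorem on `[r, 1]` and `[0, r]` fixes its sign. -/
theorem threshold_lt_iff {f h : ℝ → ℝ} {c : ℝ} (hh : Continuous h) (h0 : h 0 < 0) (h1 : 0 < h 1)
    (hf : ∀ x, f x = (x - 1) * h x) (hc : ∀ x, (x ∈ Set.Ico (0 : ℝ) 1 ∧ f x = 0) ↔ x = c)
    (hr0 : 0 < r) (hr1 : r < 1) : c < r ↔ f r < 0 := by
  have hneg : f r < 0 ↔ 0 < h r := by
    rw [hf, ← neg_pos, ← neg_mul, neg_sub]
    exact mul_pos_iff_of_pos_left (by linarith)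
  have root : ∀ x, 0 ≤ x → x ≤ 1 → h x = 0 → x = c := fun x hx0 hx1 hx =>
    (hc x).1 ⟨⟨hx0, lt_of_le_of_ne hx1 (by rintro rfl; linarith)⟩, by rw [hf, hx, mul_zero]⟩
  rw [hneg]
  constructor
  · intro hcr
    by_contra! hle
    obtain ⟨x, hx, ex⟩ := intermediate_value_Icc hr1.le hh.continuousOn
      (show (0 : ℝ) ∈ Set.Icc _ _ from ⟨hle, h1.le⟩)
    have := root x (hr0.le.trans hx.1) hx.2 ex
    have := hx.1
    linarith
  · intro hpos
    obtain ⟨x, hx, ex⟩ := intermediate_value_Icc hr0.le hh.continuousOn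
      (show (0 : ℝ) ∈ Set.Icc _ _ from ⟨h0.le, hpos.le⟩)
    rw [← root x hx.1 (hx.2.trans hr1.le) ex]
    refine lt_of_le_of_ne hx.2 ?_
    rintro rfl
    linarith

theorem lambdaThreshold_lt_iff (hr0 : 0 < r) (hr1 : r < 1) {n : ℕ} (hn : 1 ≤ n) :
    lambdaThreshold n < r ↔ lambdaPoly n r < 0 := by
  rcases Nat.lt_or_ge n 2 with h | h
  -- For `n = 1` the cofactor `x` vanishes at `0`, so `threshold_lt_iff` does not apply.
  · obtain rfl : n = 1 := by omega
    have h0 : (0 : ℝ) = lambdaThreshold 1 :=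
      (lambdaPoly_eq_zero_iff 1 le_rfl 0).1 ⟨⟨le_rfl, one_pos⟩, by norm_num [lambdaPoly]⟩
    have : lambdaPoly 1 r < 0 := by
      have e : lambdaPoly 1 r = r * (r - 1) := by unfold lambdaPoly; ring
      rw [e]
      exact mul_neg_of_pos_of_neg hr0 (by linarith)
    rw [← h0]
    exact iff_of_true hr0 this
  · refine threshold_lt_iff (by fun_prop) ?_ ?_ (lambdaPoly_eq n h) (lambdaPoly_eq_zero_iff n hn)
      hr0 hr1
    · rw [Finset.sum_eq_zero fun k hk => zero_pow (by simp at hk; omega), zero_geom_sum,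
        if_neg (by omega)]
      norm_num
    · simp
      omega

theorem gammaThreshold_lt_iff (hr0 : 0 < r) (hr1 : r < 1) (n : ℕ) :
    gammaThreshold n < r ↔ gammaPoly n r < 0 := by
  refine threshold_lt_iff (by fun_prop) ?_ ?_ (gammaPoly_eq n) (gammaPoly_eq_zero_iff n) hr0 hr1
  · rw [Finset.sum_eq_zero fun k hk => zero_pow (by simp at hk; omega), zero_geom_sum,
      if_neg (by omega)]
    norm_num
  · simp only [one_pow, Finset.sum_const, nsmul_eq_mul, mul_one, sub_pos, Nat.cast_lt]
    rw [Finset.card_insert_of_notMem (by simp only [Finset.mem_Ico]; omega)]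
    simp
    omega

theorem lambdaPoly_le_succ (hr0 : 0 < r) (hr1 : r < 1) (n : ℕ) :
    lambdaPoly (n + 1) r ≤ lambdaPoly (n + 2) r := by
  have e : ∀ m, lambdaPoly (m + 1) r = (1 - r ^ (m + 1)) ^ 2 - r ^ m * (1 - r) := fun m => by
    unfold lambdaPoly
    rw [Nat.add_sub_cancel]
    ring
  have h1 : r ^ (n + 2) ≤ r ^ (n + 1) := pow_le_pow_of_le_one hr0.le hr1.le (by omega)
  have h2 : r ^ (n + 1) ≤ r ^ n := pow_le_pow_of_le_one hr0.le hr1.le (by omega)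
  have h3 : r ^ (n + 1) ≤ 1 := pow_le_one₀ hr0.le hr1.le
  have h4 : 0 ≤ 1 - r := by linarith
  rw [e n, e (n + 1)]
  have h5 : 0 ≤ 1 - r ^ (n + 1) := by linarith
  gcongr

theorem gammaPoly_le_succ (hr0 : 0 < r) (hr1 : r < 1) (n : ℕ) :
    gammaPoly n r ≤ gammaPoly (n + 1) r := by
  have e : ∀ m, gammaPoly m r =
      (1 - r ^ (m + 1)) * (1 - r ^ (3 * m + 3)) - r ^ (2 * m + 1) * (1 - r) := fun m => by
    unfold gammaPoly
    ring
  have h1 : r ^ (n + 1 + 1) ≤ r ^ (n + 1) := pow_le_pow_of_le_one hr0.le hr1.le (by omega)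
  have h2 : r ^ (2 * (n + 1) + 1) ≤ r ^ (2 * n + 1) :=
    pow_le_pow_of_le_one hr0.le hr1.le (by omega)
  have h3 : r ^ (3 * (n + 1) + 3) ≤ r ^ (3 * n + 3) :=
    pow_le_pow_of_le_one hr0.le hr1.le (by omega)
  have h4 : 0 ≤ 1 - r := by linarith
  have h5 : 0 ≤ 1 - r ^ (n + 1) := sub_nonneg.2 (pow_le_one₀ hr0.le hr1.le)
  have h6 : 0 ≤ 1 - r ^ (3 * n + 3) := sub_nonneg.2 (pow_le_one₀ hr0.le hr1.le)
  have h7 : 0 ≤ 1 - r ^ (n + 1 + 1) := sub_nonneg.2 (pow_le_one₀ hr0.le hr1.le)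
  rw [e n, e (n + 1)]
  gcongr

theorem exists_lambdaPoly_nonneg (hr0 : 0 < r) (hr1 : r < 1) :
    ∃ n, 1 ≤ n ∧ 0 ≤ lambdaPoly (2 * n - 1) r := by
  obtain ⟨n, hn⟩ := exists_pow_lt_of_lt_one (show (0 : ℝ) < 1 / 2 by norm_num) hr1
  refine ⟨n + 1, by omega, ?_⟩
  have h1 : r ^ (2 * (n + 1) - 1) ≤ r ^ n := pow_le_pow_of_le_one hr0.le hr1.le (by omega)
  have h2 : r ^ (2 * (n + 1) - 1 - 1) ≤ r ^ n := pow_le_pow_of_le_one hr0.le hr1.le (by omega)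
  have h3 : 0 ≤ r ^ (2 * (2 * (n + 1) - 1)) := by positivity
  unfold lambdaPoly
  linarith

theorem exists_gammaPoly_nonneg (hr0 : 0 < r) (hr1 : r < 1) :
    ∃ n, 1 ≤ n ∧ 0 ≤ gammaPoly (2 * n - 1) r := by
  obtain ⟨n, hn⟩ := exists_pow_lt_of_lt_one (show (0 : ℝ) < 1 / 3 by norm_num) hr1
  refine ⟨n + 1, by omega, ?_⟩
  have h1 : r ^ (3 * (2 * (n + 1) - 1) + 3) ≤ r ^ n :=
    pow_le_pow_of_le_one hr0.le hr1.le (by omega)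
  have h2 : r ^ (2 * (2 * (n + 1) - 1) + 1) ≤ r ^ n :=
    pow_le_pow_of_le_one hr0.le hr1.le (by omega)
  have h3 : r ^ (2 * (n + 1) - 1 + 1) ≤ r ^ n := pow_le_pow_of_le_one hr0.le hr1.le (by omega)
  have h4 : 0 ≤ r ^ (4 * (2 * (n + 1) - 1) + 4) := by positivity
  have h5 : 0 ≤ r ^ (2 * (2 * (n + 1) - 1) + 2) := by positivity
  unfold gammaPoly
  linarith

/-- A downward closed `p` that fails somewhere switches at most once, so the set is a singleton or
empty; `sSup ∅ = 0` gives the empty interval. -/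
theorem mem_Icc_sSup_iff {p : ℕ → Prop} (hp : ∀ n, 1 ≤ n → p (n + 1) → p n)
    (hN : ∃ n, 1 ≤ n ∧ ¬ p n) (i : ℕ) :
    i ∈ Finset.Icc 1 (sSup {n | 1 ≤ n ∧ p n ∧ ¬ p (n + 1)}) ↔ 1 ≤ i ∧ p i := by
  classical
  have hle : ∀ m n, 1 ≤ m → m ≤ n → p n → p m := by
    intro m n hm hmn
    induction n, hmn using Nat.le_induction with
    | base => exact id
    | succ n hmn ih => exact fun h => ih (hp n (hm.trans hmn) h)
  rw [Finset.mem_Icc]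
  refine and_congr_right fun hi => ?_
  by_cases h1 : p 1
  · obtain ⟨hN1, hN2⟩ := Nat.find_spec hN
    have hmin := fun {m : ℕ} (h : m < Nat.find hN) => Nat.find_min hN h
    set N := Nat.find hN
    have hN3 : N ≠ 1 := fun h => hN2 (h ▸ h1)
    have hlt : ∀ m, 1 ≤ m → (p m ↔ m < N) := fun m hm =>
      ⟨fun h => by by_contra! h'; exact hN2 (hle N m hN1 h' h),
        fun h => by by_contra h'; exact hmin h ⟨hm, h'⟩⟩
    have hS : {n | 1 ≤ n ∧ p n ∧ ¬ p (n + 1)} = {N - 1} := by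
      ext n
      simp only [Set.mem_ofPred_eq, Set.mem_singleton_iff]
      constructor
      · rintro ⟨hn, h2, h3⟩
        rw [hlt n hn] at h2
        rw [hlt (n + 1) (by omega)] at h3
        omega
      · rintro rfl
        rw [hlt _ (by omega), hlt _ (by omega)]
        omega
    rw [hS, csSup_singleton, hlt i hi]
    omega
  · have hS : {n | 1 ≤ n ∧ p n ∧ ¬ p (n + 1)} = ∅ := by
      ext n
      simp only [Set.mem_ofPred_eq, Set.mem_empty_iff_false, iff_false]
      rintro ⟨hn, h2, -⟩
      exact h1 (hle 1 n le_rfl hn h2)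
    rw [hS, csSup_empty]
    simp only [bot_eq_zero]
    exact ⟨fun h => by omega, fun h => absurd (hle 1 i le_rfl hi h) h1⟩

theorem mem_Icc_m₁ (hr0 : 0 < r) (hr1 : r < 1) (i : ℕ) :
    i ∈ Finset.Icc 1 (m₁ r) ↔ 1 ≤ i ∧ lambdaPoly (2 * i - 1) r < 0 := by
  have hS : m₁ r = sSup {n : ℕ | 1 ≤ n ∧ lambdaPoly (2 * n - 1) r < 0 ∧
      ¬ lambdaPoly (2 * (n + 1) - 1) r < 0} := by
    rw [m₁]
    congr 1
    ext n
    refine and_congr_right fun hn => ?_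
    rw [lambdaThreshold_lt_iff hr0 hr1 (by omega), ← not_lt,
      lambdaThreshold_lt_iff hr0 hr1 (by omega)]
    rfl
  rw [hS]
  refine mem_Icc_sSup_iff (p := fun n => lambdaPoly (2 * n - 1) r < 0) (fun n hn h => ?_) ?_ i
  · obtain ⟨m, rfl⟩ := Nat.exists_eq_add_of_le' hn
    exact ((lambdaPoly_le_succ hr0 hr1 (2 * m)).trans
      (lambdaPoly_le_succ hr0 hr1 (2 * m + 1))).trans_lt h
  · simpa using exists_lambdaPoly_nonneg hr0 hr1

theorem mem_Icc_m₂ (hr0 : 0 < r) (hr1 : r < 1) (i : ℕ) :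
    i ∈ Finset.Icc 1 (m₂ r) ↔ 1 ≤ i ∧ gammaPoly (2 * i - 1) r < 0 := by
  have hS : m₂ r = sSup {n : ℕ | 1 ≤ n ∧ gammaPoly (2 * n - 1) r < 0 ∧
      ¬ gammaPoly (2 * (n + 1) - 1) r < 0} := by
    rw [m₂]
    congr 1
    ext n
    refine and_congr_right fun hn => ?_
    rw [gammaThreshold_lt_iff hr0 hr1, ← not_lt, gammaThreshold_lt_iff hr0 hr1]
    rfl
  rw [hS]
  refine mem_Icc_sSup_iff (p := fun n => gammaPoly (2 * n - 1) r < 0) (fun n hn h => ?_) ?_ i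
  · obtain ⟨m, rfl⟩ := Nat.exists_eq_add_of_le' hn
    exact ((gammaPoly_le_succ hr0 hr1 (2 * m + 1)).trans
      (gammaPoly_le_succ hr0 hr1 (2 * m + 2))).trans_lt h
  · simpa using exists_gammaPoly_nonneg hr0 hr1

/-! ### Existence of the periodic orbits from the threshold inequalities. -/

theorem lambdaPoly_neg_iff (hr0 : 0 < r) (k : ℕ) : lambdaPoly (2 * k + 1) r < 0 ↔
    r * (1 - r ^ (2 * k + 1) + (r ^ (2 * k + 1)) ^ 2) < r ^ (2 * k + 1) := by
  have e : r * lambdaPoly (2 * k + 1) r =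
      r * (1 - r ^ (2 * k + 1) + (r ^ (2 * k + 1)) ^ 2) - r ^ (2 * k + 1) := by
    unfold lambdaPoly
    rw [Nat.add_sub_cancel]
    ring
  rw [← smul_neg_iff_of_pos_left hr0, smul_eq_mul, e, sub_neg]

theorem gammaPoly_neg_iff (hr0 : 0 < r) (k : ℕ) : gammaPoly (2 * k + 1) r < 0 ↔
    r * (1 + r ^ (2 * k + 1) * r ^ (2 * k + 3) + (r ^ (2 * k + 1)) ^ 2 * (r ^ (2 * k + 3)) ^ 2) <
      r ^ (2 * k + 3) * (1 + r ^ (2 * k + 1) + r ^ (2 * k + 1) * r ^ (2 * k + 3)) := by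
  have e : r * gammaPoly (2 * k + 1) r =
      r * (1 + r ^ (2 * k + 1) * r ^ (2 * k + 3) + (r ^ (2 * k + 1)) ^ 2 * (r ^ (2 * k + 3)) ^ 2) -
      r ^ (2 * k + 3) * (1 + r ^ (2 * k + 1) + r ^ (2 * k + 1) * r ^ (2 * k + 3)) := by
    unfold gammaPoly
    ring
  rw [← smul_neg_iff_of_pos_left hr0, smul_eq_mul, e, sub_neg]

/-- The factor `1 + ρ + ρ ^ 2` cancels. The lower bound becomes the hypothesis, the upper one
follows from `(1 - ρ) ^ 2 ≥ 0`. -/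
theorem balanced_self (hr0 : 0 < r) (hr1 : r < 1) {k : ℕ} (h : lambdaPoly (2 * k + 1) r < 0) :
    Balanced r k k := by
  rw [lambdaPoly_neg_iff hr0] at h
  have hρ : 0 < r ^ (2 * k + 1) := by positivity
  intro ρ σ h'
  obtain ⟨rfl, rfl⟩ := or_self_iff.1 h'
  generalize r ^ (2 * k + 1) = ρ at *
  have hp : 0 < 1 + ρ + ρ ^ 2 := by positivity
  have e : 1 + ρ * ρ + ρ ^ 2 * ρ ^ 2 = (1 - ρ + ρ ^ 2) * (1 + ρ + ρ ^ 2) := by ring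
  have e' : 1 + ρ + ρ * ρ = 1 + ρ + ρ ^ 2 := by ring
  rw [e, e', ← mul_assoc, ← mul_assoc]
  refine ⟨mul_lt_mul_of_pos_right h hp, mul_lt_mul_of_pos_right ?_ hp⟩
  have := mul_lt_of_lt_one_left hρ hr1
  nlinarith [sq_nonneg (1 - ρ)]

/-- By `hcmp` it suffices to bound the smaller third coordinate below, which is the hypothesis, and
the larger above. For the latter put `y = r ρ`, so `ρ σ = y ^ 2`, and use `(1 - y) (1 - y ^ 3) ≥ 0`.
-/
theorem balanced_succ (hr0 : 0 < r) (hr1 : r < 1) {k : ℕ} (h : gammaPoly (2 * k + 1) r < 0) :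
    Balanced r k (k + 1) := by
  rw [gammaPoly_neg_iff hr0] at h
  have hρ : 0 < r ^ (2 * k + 1) := by positivity
  have hρ1 : r ^ (2 * k + 1) ≤ 1 := pow_le_one₀ hr0.le hr1.le
  have hσ : 0 < r ^ (2 * k + 3) := by positivity
  have hσρ : r ^ (2 * k + 3) ≤ r ^ (2 * k + 1) := pow_le_pow_of_le_one hr0.le hr1.le (by omega)
  have e : r ^ (2 * k + 3) = r * (r * r ^ (2 * k + 1)) := by ring
  have key : r * (r ^ (2 * k + 1) *
      (1 + r ^ (2 * k + 3) + r ^ (2 * k + 1) * r ^ (2 * k + 3))) <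
      1 + r ^ (2 * k + 1) * r ^ (2 * k + 3) + (r ^ (2 * k + 1)) ^ 2 * (r ^ (2 * k + 3)) ^ 2 := by
    rw [e]
    generalize r ^ (2 * k + 1) = ρ at *
    have hP : 0 < r * ρ := by positivity
    have hP1 : r * ρ < 1 := by nlinarith
    have h3 : (r * ρ) ^ 3 ≤ 1 := pow_le_one₀ hP.le hP1.le
    have h1 := mul_nonneg (sub_nonneg.2 hP1.le) (sub_nonneg.2 h3)
    have h2 := mul_lt_of_lt_one_left (pow_pos hP 2) hr1
    linarith
  have hcmp : r ^ (2 * k + 3) * (1 + r ^ (2 * k + 1) + r ^ (2 * k + 1) * r ^ (2 * k + 3)) ≤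
      r ^ (2 * k + 1) * (1 + r ^ (2 * k + 3) + r ^ (2 * k + 1) * r ^ (2 * k + 3)) := by
    have := mul_nonneg (sub_nonneg.2 hσρ)
      (show 0 ≤ 1 + r ^ (2 * k + 1) * r ^ (2 * k + 3) by positivity)
    linarith
  intro ρ σ h'
  rw [show 2 * (k + 1) + 1 = 2 * k + 3 by ring] at h'
  rcases h' with ⟨rfl, rfl⟩ | ⟨rfl, rfl⟩
  · exact ⟨h.trans_le hcmp, key⟩
  · rw [mul_comm (r ^ (2 * k + 3)) (r ^ (2 * k + 1)), mul_comm ((r ^ (2 * k + 3)) ^ 2)]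
    exact ⟨h, (mul_le_mul_of_nonneg_left hcmp hr0.le).trans_lt key⟩

/-! ### Convergence to the periodic orbits -/

theorem range_iterate_eq {α : Type*} {f : α → α} {x : α} (hx : x ∈ Function.periodicPts f)
    (m : ℕ) : Set.range (fun n : ℕ => f^[n] (f^[m] x)) = Set.range fun n : ℕ => f^[n] x := by
  obtain ⟨P, hP, hPx⟩ := hx
  ext y
  simp only [Set.mem_range, ← Function.iterate_add_apply]
  constructor
  · rintro ⟨n, rfl⟩
    exact ⟨n + m, rfl⟩
  · rintro ⟨n, rfl⟩
    -- The extra steps complete the first `m` to a multiple of the period.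
    refine ⟨n + (m * P - m), ?_⟩
    have : m ≤ m * P := Nat.le_mul_of_pos_right m hP
    rw [add_assoc, Nat.sub_add_cancel this, Function.iterate_add_apply, (hPx.const_mul m).eq]

theorem finite_range_iterate {α : Type*} {f : α → α} {x : α} (hx : x ∈ Function.periodicPts f) :
    (Set.range fun n : ℕ => f^[n] x).Finite := by
  obtain ⟨P, hP, hPx⟩ := hx
  refine ((Finset.range P).finite_toSet.image fun n => f^[n] x).subset ?_
  rintro _ ⟨n, rfl⟩
  exact ⟨n % P, by simpa using Nat.mod_lt n hP, hPx.iterate_mod_apply n⟩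

/-- The pair of block indices of one of the periodic orbits that exist for the parameter `r`. -/
def Admissible (r : ℝ) (k k' : ℕ) : Prop :=
  (k' = k ∧ lambdaPoly (2 * k + 1) r < 0) ∨ (k' = k + 1 ∧ gammaPoly (2 * k + 1) r < 0)

theorem Admissible.balanced (hr0 : 0 < r) (hr1 : r < 1) {k k' : ℕ} (h : Admissible r k k') :
    Balanced r k k' := by
  rcases h with ⟨rfl, h⟩ | ⟨rfl, h⟩
  · exact balanced_self hr0 hr1 h
  · exact balanced_succ hr0 hr1 h

theorem Alternates.admissible (hr0 : 0 < r) (hr1 : r < 1) {s : State} {k k' : ℕ}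
    (hs : BlockRegular r s) (hC : r < thd s) (h : Alternates r k k' s)
    (hk : k' = k ∨ k' = k + 1) : Admissible r k k' := by
  have hlt := h.lt hr0 hr1 hs hC rfl rfl
  rcases hk with rfl | rfl
  · refine Or.inl ⟨rfl, (lambdaPoly_neg_iff hr0 _).2 ?_⟩
    have hρ : 0 < r ^ (2 * k' + 1) := by positivity
    generalize r ^ (2 * k' + 1) = ρ at *
    refine lt_of_mul_lt_mul_right ?_ (show 0 ≤ 1 + ρ + ρ * ρ by positivity)
    linarith
  · exact Or.inr ⟨rfl, (gammaPoly_neg_iff hr0 _).2 hlt⟩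

theorem NonSingular.exists_dist_eq (hr0 : 0 < r) (hr1 : r < 1) {z : ℂ} (hz : NonSingular r z) :
    ∃ (N : ℕ) (k k' : ℕ) (i : Fin 3) (c : ℝ), Admissible r k k' ∧
      ∀ n, dist ((T r)^[n] ((T r)^[N] z)) ((T r)^[n] (point r (periodicState r k k' i))) =
        r ^ n * c := by
  obtain ⟨s, hs, rfl⟩ := hz.exists_regular hr0 hr1
  obtain ⟨M, hM⟩ := hs.exists_blockRegular hr0 hr1
  obtain ⟨N, k, k', hk, hC, halt⟩ := hM.exists_alternates hr0 hr1
  have hN := hM.iterate hr0 hr1 N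
  have hadm := halt.admissible hr0 hr1 hN hC hk
  have hbal := hadm.balanced hr0 hr1
  rw [← hM.iterate_blockTime hr0 hr1, ← Function.iterate_add_apply] at hN halt
  set L := blockTime r ((step r)^[M] s) N + M
  refine ⟨L, k, k', ((step r)^[L] s).1,
    dist (point r ((step r)^[L] s)) (point r (periodicState r k k' ((step r)^[L] s).1)), hadm,
    fun n => ?_⟩
  have hp := blockRegular_periodicState hr0 hr1 hbal ((step r)^[L] s).1
  have halt' := alternates_periodicState hr0 hr1 hbal ((step r)^[L] s).1
  rw [hs.iterate_T hr0 hr1]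
  refine dist_iterate hr0 hr1 (hs.iterate hr0 L) (hp.regular hr0 hr1) (fun n => ?_) n
  refine step_iterate_fst_congr hr0 hr1 n _ _ hN hp rfl fun m => ?_
  rcases Nat.even_or_odd' m with ⟨j, rfl | rfl⟩
  · rw [(halt j).1, (halt' j).1]
  · rw [(halt j).2, (halt' j).2]

theorem Admissible.mem_periodicPts (hr0 : 0 < r) (hr1 : r < 1) {k k' : ℕ}
    (h : Admissible r k k') : point r (periodicState r k k' 0) ∈ Function.periodicPts (T r) := by
  have hb := h.balanced hr0 hr1
  have hs := (blockRegular_periodicState hr0 hr1 hb 0).regular hr0 hr1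
  rw [← Function.minimalPeriod_pos_iff_mem_periodicPts, hs.minimalPeriod_T hr0 hr1]
  rcases h with ⟨rfl, h⟩ | ⟨rfl, h⟩
  · rw [minimalPeriod_periodicState_self hr0 hr1 hb]; omega
  · rw [minimalPeriod_periodicState_of_ne hr0 hr1 hb (by omega)]; omega

theorem NonSingular.exists_orbitTendsto (hr0 : 0 < r) (hr1 : r < 1) {z : ℂ}
    (hz : NonSingular r z) : ∃ k k', Admissible r k k' ∧ OrbitTendsto r z (periodicOrbit r k k') ∧
      (z ∈ Function.periodicPts (T r) →
        Set.range (fun n : ℕ => (T r)^[n] z) = periodicOrbit r k k') := by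
  obtain ⟨N, k, k', i, c, hadm, hc⟩ := hz.exists_dist_eq hr0 hr1
  have hbal := hadm.balanced hr0 hr1
  obtain ⟨m, hm⟩ := exists_step_iterate_periodicState hr0 hr1 hbal i
  have hs := (blockRegular_periodicState hr0 hr1 hbal 0).regular hr0 hr1
  rw [← hm, ← hs.iterate_T hr0 hr1] at hc
  have hper := hadm.mem_periodicPts hr0 hr1
  have hlim : Tendsto (fun n : ℕ => r ^ n * c) atTop (𝓝 0) := by
    simpa using (tendsto_pow_atTop_nhds_zero_of_lt_one hr0.le hr1).mul_const c
  refine ⟨k, k', hadm, ?_, fun hzper => ?_⟩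
  · refine (tendsto_add_atTop_iff_nat N).1 ?_
    refine squeeze_zero (fun _ => Metric.infDist_nonneg) (fun n => ?_) hlim
    rw [← hc n, Function.iterate_add_apply]
    refine Metric.infDist_le_dist_of_mem ⟨n + m, ?_⟩
    exact Function.iterate_add_apply _ _ _ _
  · have heq : (T r)^[N] z = (T r)^[m] (point r (periodicState r k k' 0)) := by
      obtain ⟨P, hP, hPz⟩ := hzper
      obtain ⟨Q, hQ, hQz⟩ := hper
      have h1 := fun n : ℕ => ((hPz.apply_iterate N).mul_const (Q * n)).eq
      have h2 := fun n : ℕ => ((hQz.apply_iterate m).const_mul P).mul_const n |>.eq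
      -- At multiples of `P * Q` both orbits have returned, so the distance is constant there while
      -- it tends to `0`.
      have hconst : ∀ n : ℕ, dist ((T r)^[N] z) ((T r)^[m] (point r (periodicState r k k' 0)))
          = r ^ (P * Q * n) * c := fun n => by
        rw [← hc, h2, mul_assoc, h1]
      rw [← dist_eq_zero]
      have hPQ : Tendsto (fun n : ℕ => P * Q * n) atTop atTop :=
        tendsto_id.const_mul_atTop' (Nat.mul_pos hP hQ)
      exact tendsto_nhds_unique tendsto_const_nhds
        ((hlim.comp hPQ).congr fun n => (hconst n).symm)
    rw [periodicOrbit, ← range_iterate_eq hzper N, heq, range_iterate_eq hper]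

/-! ### Limit sets and asymptotic periodicity. -/

theorem OrbitTendsto.omegaLimit_subset {z : ℂ} {Γ : Set ℂ} (h : OrbitTendsto r z Γ)
    (hΓ : IsClosed Γ) (hne : Γ.Nonempty) :
    omegaLimit atTop (fun (n : ℕ) (x : ℂ) => (T r)^[n] x) {z} ⊆ Γ := by
  intro y hy
  rw [hΓ.mem_iff_infDist_zero hne]
  by_contra hpos
  have hpos := lt_of_le_of_ne Metric.infDist_nonneg (Ne.symm hpos)
  rw [mem_omegaLimit_iff_frequently] at hy
  have h1 := hy _ (Metric.ball_mem_nhds y (half_pos hpos))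
  have h2 := h.eventually (gt_mem_nhds (half_pos hpos))
  obtain ⟨n, ⟨w, hw, h3⟩, h4⟩ := (h1.and_eventually h2).exists
  obtain rfl : w = z := hw
  have h5 : dist ((T r)^[n] w) y < _ := h3
  have := Metric.infDist_le_infDist_add_dist (s := Γ) (x := y) (y := (T r)^[n] w)
  rw [dist_comm] at this
  linarith

theorem IsPeriodicOrbit.subset_omegaSet {p : ℕ} {Γ : Set ℂ} (h : IsPeriodicOrbit r p Γ) :
    Γ ⊆ omegaSet r := by
  obtain ⟨z, hz, hp, hmin, rfl⟩ := h
  rintro _ ⟨n, rfl⟩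
  simp only [omegaSet, Set.mem_iUnion]
  refine ⟨z, hz, ?_⟩
  rw [mem_omegaLimit_iff_frequently]
  intro U hU
  rw [frequently_atTop]
  intro a
  refine ⟨n + a * p, by nlinarith, z, rfl, ?_⟩
  have hper : Function.IsPeriodicPt (T r) p z := hmin ▸ Function.isPeriodicPt_minimalPeriod _ _
  change (T r)^[n + a * p] z ∈ U
  rw [Function.iterate_add_apply, (hper.const_mul a).eq]
  exact mem_of_mem_nhds hU

theorem IsPeriodicOrbit.finite {p : ℕ} {Γ : Set ℂ} (h : IsPeriodicOrbit r p Γ) :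
    Γ.Finite ∧ Γ.Nonempty := by
  obtain ⟨z, hz, hp, hmin, rfl⟩ := h
  exact ⟨finite_range_iterate (Function.minimalPeriod_pos_iff_mem_periodicPts.1 (hmin ▸ hp)),
    Set.range_nonempty _⟩

theorem asymptoticallyPeriodic_of_finite {𝒢 : Set (Set ℂ)} (hfin : 𝒢.Finite)
    (hper : ∀ Γ ∈ 𝒢, ∃ p : ℕ, IsPeriodicOrbit r p Γ)
    (hconv : ∀ z : ℂ, NonSingular r z → ∃ Γ ∈ 𝒢, OrbitTendsto r z Γ) :
    AsymptoticallyPeriodic r := by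
  refine ⟨𝒢, hfin, hper, Set.Subset.antisymm ?_ ?_, hconv⟩
  · refine Set.iUnion₂_subset fun z hz => ?_
    obtain ⟨Γ, hΓ, h⟩ := hconv z hz
    obtain ⟨p, hp⟩ := hper Γ hΓ
    exact (h.omegaLimit_subset hp.finite.1.isClosed hp.finite.2).trans
      (Set.subset_sUnion_of_mem hΓ)
  · refine Set.sUnion_subset fun Γ hΓ => ?_
    obtain ⟨p, hp⟩ := hper Γ hΓ
    exact hp.subset_omegaSet

end TriangleBilliard

end

/-! ### The classification of periodic orbits. -/

open TriangleBilliard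

theorem mainTheorem1 (r : ℝ) (hr0 : 0 < r) (hr1 : r < 1) :
    ∃ Γ₁ Γ₂ : ℕ → Set ℂ,
      (∀ i ∈ Finset.Icc 1 (TriangleBilliard.m₁ r),
        TriangleBilliard.IsPeriodicOrbit r (3 * (2 * i - 1)) (Γ₁ i)) ∧
      (∀ i ∈ Finset.Icc 1 (TriangleBilliard.m₂ r),
        TriangleBilliard.IsPeriodicOrbit r (12 * i) (Γ₂ i)) ∧
      (∀ i ∈ Finset.Icc 1 (TriangleBilliard.m₁ r), ∀ j ∈ Finset.Icc 1 (TriangleBilliard.m₁ r),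
        Γ₁ i = Γ₁ j → i = j) ∧
      (∀ i ∈ Finset.Icc 1 (TriangleBilliard.m₂ r), ∀ j ∈ Finset.Icc 1 (TriangleBilliard.m₂ r),
        Γ₂ i = Γ₂ j → i = j) ∧
      (∀ i ∈ Finset.Icc 1 (TriangleBilliard.m₁ r), ∀ j ∈ Finset.Icc 1 (TriangleBilliard.m₂ r),
        Γ₁ i ≠ Γ₂ j) ∧
      (∀ (p : ℕ) (Γ : Set ℂ), TriangleBilliard.IsPeriodicOrbit r p Γ →
        (∃ i ∈ Finset.Icc 1 (TriangleBilliard.m₁ r), Γ = Γ₁ i) ∨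
        (∃ i ∈ Finset.Icc 1 (TriangleBilliard.m₂ r), Γ = Γ₂ i)) ∧
      (∀ z : ℂ, TriangleBilliard.NonSingular r z →
        (∃ j ∈ Finset.Icc 1 (TriangleBilliard.m₁ r), TriangleBilliard.OrbitTendsto r z (Γ₁ j)) ∨
        (∃ j ∈ Finset.Icc 1 (TriangleBilliard.m₂ r), TriangleBilliard.OrbitTendsto r z (Γ₂ j))) ∧
      TriangleBilliard.AsymptoticallyPeriodic r := by
  have e1 : ∀ i, i ∈ Finset.Icc 1 (m₁ r) → ∃ k, i = k + 1 ∧ lambdaPoly (2 * k + 1) r < 0 := by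
    intro i hi
    obtain ⟨h1, h2⟩ := (mem_Icc_m₁ hr0 hr1 i).1 hi
    obtain ⟨k, rfl⟩ := Nat.exists_eq_add_of_le' h1
    exact ⟨k, rfl, h2⟩
  have e2 : ∀ i, i ∈ Finset.Icc 1 (m₂ r) → ∃ k, i = k + 1 ∧ gammaPoly (2 * k + 1) r < 0 := by
    intro i hi
    obtain ⟨h1, h2⟩ := (mem_Icc_m₂ hr0 hr1 i).1 hi
    obtain ⟨k, rfl⟩ := Nat.exists_eq_add_of_le' h1
    exact ⟨k, rfl, h2⟩
  -- The threshold index `2 i - 1 = 2 k + 1` corresponds to the block index `k = i - 1`; only `i ≥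
  -- 1` occurs.
  set Γ₁ : ℕ → Set ℂ := fun i => periodicOrbit r (i - 1) (i - 1)
  set Γ₂ : ℕ → Set ℂ := fun i => periodicOrbit r (i - 1) i
  have p1 : ∀ i ∈ Finset.Icc 1 (m₁ r), IsPeriodicOrbit r (3 * (2 * i - 1)) (Γ₁ i) := by
    intro i hi
    obtain ⟨k, rfl, h⟩ := e1 i hi
    exact isPeriodicOrbit_self hr0 hr1 (balanced_self hr0 hr1 h)
  have p2 : ∀ i ∈ Finset.Icc 1 (m₂ r), IsPeriodicOrbit r (12 * i) (Γ₂ i) := by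
    intro i hi
    obtain ⟨k, rfl, h⟩ := e2 i hi
    have := isPeriodicOrbit_of_ne hr0 hr1 (balanced_succ hr0 hr1 h) (by omega)
    rwa [show 6 * (k + (k + 1) + 1) = 12 * (k + 1) by ring] at this
  have hadm : ∀ k k', Admissible r k k' →
      (∃ i ∈ Finset.Icc 1 (m₁ r), periodicOrbit r k k' = Γ₁ i) ∨
      (∃ i ∈ Finset.Icc 1 (m₂ r), periodicOrbit r k k' = Γ₂ i) := by
    rintro k k' (⟨rfl, h⟩ | ⟨rfl, h⟩)
    · exact Or.inl ⟨k' + 1, (mem_Icc_m₁ hr0 hr1 _).2 ⟨by omega, h⟩, rfl⟩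
    · exact Or.inr ⟨k + 1, (mem_Icc_m₂ hr0 hr1 _).2 ⟨by omega, h⟩, rfl⟩
  have hconv : ∀ z : ℂ, NonSingular r z →
      (∃ j ∈ Finset.Icc 1 (m₁ r), OrbitTendsto r z (Γ₁ j)) ∨
      (∃ j ∈ Finset.Icc 1 (m₂ r), OrbitTendsto r z (Γ₂ j)) := by
    intro z hz
    obtain ⟨k, k', h, hlim, -⟩ := hz.exists_orbitTendsto hr0 hr1
    rcases hadm k k' h with ⟨i, hi, e⟩ | ⟨i, hi, e⟩
    · exact Or.inl ⟨i, hi, e ▸ hlim⟩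
    · exact Or.inr ⟨i, hi, e ▸ hlim⟩
  refine ⟨Γ₁, Γ₂, p1, p2, ?_, ?_, ?_, ?_, hconv, ?_⟩
  · intro i hi j hj h
    have := (p1 i hi).period_eq (h ▸ p1 j hj)
    have := (Finset.mem_Icc.1 hi).1
    have := (Finset.mem_Icc.1 hj).1
    omega
  · intro i hi j hj h
    have := (p2 i hi).period_eq (h ▸ p2 j hj)
    omega
  · intro i hi j hj h
    -- One period is odd, the other even.
    have := (p1 i hi).period_eq (h ▸ p2 j hj)
    have := (Finset.mem_Icc.1 hi).1
    omega
  · rintro p _ ⟨z, hz, hp, hmin, rfl⟩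
    obtain ⟨k, k', h, -, hrange⟩ := hz.exists_orbitTendsto hr0 hr1
    rw [hrange (Function.minimalPeriod_pos_iff_mem_periodicPts.1 (hmin ▸ hp))]
    exact hadm k k' h
  · refine asymptoticallyPeriodic_of_finite
      (𝒢 := Γ₁ '' Finset.Icc 1 (m₁ r) ∪ Γ₂ '' Finset.Icc 1 (m₂ r))
      (((Finset.finite_toSet _).image _).union ((Finset.finite_toSet _).image _)) ?_ ?_
    · rintro _ (⟨i, hi, rfl⟩ | ⟨i, hi, rfl⟩)
      · exact ⟨_, p1 i hi⟩
      · exact ⟨_, p2 i hi⟩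
    · intro z hz
      rcases hconv z hz with ⟨j, hj, h⟩ | ⟨j, hj, h⟩
      · exact ⟨_, Or.inl ⟨j, hj, rfl⟩, h⟩
      · exact ⟨_, Or.inr ⟨j, hj, rfl⟩, h⟩
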